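/- Let $d\in\mathbb{N}_0$, let $\mathbb{R}^d_+=(0,\infty)^d$ and let $\overline{\mathbb{R}^d_+}$ be its closure. Let $\mathcal S(\mathbb{R}^d)$ be the Schwartz space of complex-valued functions on $\mathbb{R}^d$, and let $\mathcal S(\mathbb{R}^d_+)$ be the space of all $f\in C^\infty(\mathbb{R}^d_+)$ with complex values such that every derivative $D^pf$, $p\in\mathbb{N}_0^d$, extends to a continuous function on $\overline{\mathbb{R}^d_+}$ and $$\sup_{x\in\mathbb{R}^d_+}x^k|D^pf(x)|<\infty\qquad\text{for all }k,p\in\mathbb{N}_0^d,$$ with the locally convex topology defined by these seminorms. Let $\mathcal S'(\mathbb{R}^d)$ and $\mathcal S'(\mathbb{R}^d_+)$ be the topological duals of these spaces, with the strong topology (uniform convergence on bounded sets). (1) The restriction map $R:\mathcal S(\mathbb{R}^d)\to\mathcal S(\mathbb{R}^d_+)$, $f\mapsto f|_{\mathbb{R}^d_+}$, is a topological homomorphism onto; that is, it is linear, continuous, open and surjective. (2) Let $N=\{f\in\mathcal S(\mathbb{R}^d):\operatorname{supp}f\subseteq\mathbb{R}^d\setminus\mathbb{R}^d_+\}$. The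 map $R$ induces a linear topological isomorphism $\mathcal S(\mathbb{R}^d)/N\cong\mathcal S(\mathbb{R}^d_+)$, $f+N\mapsto f|_{\mathbb{R}^d_+}$, where the left side carries the quotient topology. (3) The set of all tempered distributions $T\in\mathcal S'(\mathbb{R}^d)$ with $\operatorname{supp}T\subseteq\overline{\mathbb{R}^d_+}$ is a closed linear subspace of $\mathcal S'(\mathbb{R}^d)$, and the transpose $T\mapsto T\circ R$ is a linear topological isomorphism of $\mathcal S'(\mathbb{R}^d_+)$ onto this subspace with the induced topology. -/

import Mathlib

open scoped SchwartzMap ContDiff Topology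

noncomputable section

namespace OrthantSchwartz

/-- The Euclidean space `ℝ^d`. -/
abbrev Euc (d : ℕ) : Type := EuclideanSpace ℝ (Fin d)

/-- The open orthant `(0, ∞)^d` in `ℝ^d`. -/
def orthant (d : ℕ) : Set (Euc d) := {x | ∀ i, 0 < x i}

/-- The monomial `x^k = ∏ i, x_i^{k_i}`. -/
def monomial {d : ℕ} (k : Fin d → ℕ) (x : Euc d) : ℝ := ∏ i, x i ^ k i

/-- The partial derivative `D^p f = ∂_1^{p_1} ⋯ ∂_d^{p_d} f`: the iterated derivative of order
`|p|` evaluated at the list of coordinate vectors in which `e_i` occurs exactly `p_i` times. -/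
def partialDeriv {d : ℕ} (p : Fin d → ℕ) (f : Euc d → ℂ) (x : Euc d) : ℂ :=
  iteratedFDeriv ℝ (∑ i, p i) f x
    (fun j => EuclideanSpace.single (finSigmaFinEquiv.symm j).1 (1 : ℝ))

/-- Extension by zero of a function on the open orthant. It only serves to speak about derivatives
at points of the orthant; these depend only on values in the orthant, which is open. -/
def extendZero {d : ℕ} (f : orthant d → ℂ) : Euc d → ℂ := Function.extend Subtype.val f 0

/-- Membership in `𝓢(ℝ^d_+)`: `f` is smooth on the open orthant, every derivative `D^p f` extends to
a continuous function on the closed orthant, and `x^k |D^p f(x)|` is bounded on the open orthant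
for all multi-indices `k`, `p`. -/
structure IsSchwartz {d : ℕ} (f : orthant d → ℂ) : Prop where
  smooth : ContDiffOn ℝ ∞ (extendZero f) (orthant d)
  extends_continuously : ∀ p : Fin d → ℕ, ∃ g : Euc d → ℂ,
    ContinuousOn g (closure (orthant d)) ∧ ∀ x ∈ orthant d, g x = partialDeriv p (extendZero f) x
  decay : ∀ k p : Fin d → ℕ, ∃ C : ℝ, ∀ x ∈ orthant d,
    monomial k x * ‖partialDeriv p (extendZero f) x‖ ≤ C

theorem isOpen_orthant (d : ℕ) : IsOpen (orthant d) := by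
  have h : orthant d = ⋂ i : Fin d, {x : Euc d | 0 < x i} := by
    ext x; simp [orthant]
  rw [h]
  refine isOpen_iInter_of_finite fun i => isOpen_lt continuous_const ?_
  fun_prop

theorem one_mem_orthant (d : ℕ) : (WithLp.toLp 2 fun _ => (1 : ℝ) : Euc d) ∈ orthant d := by
  intro i; simp

instance instNonemptyOrthant (d : ℕ) : Nonempty (orthant d) := ⟨⟨_, one_mem_orthant d⟩⟩

theorem extendZero_apply {d : ℕ} (f : orthant d → ℂ) (x : orthant d) :
    extendZero f x = f x :=
  Subtype.val_injective.extend_apply f 0 x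

theorem extendZero_add {d : ℕ} (f g : orthant d → ℂ) :
    extendZero (f + g) = extendZero f + extendZero g := by
  funext x
  by_cases hx : x ∈ orthant d
  · have h := fun u : orthant d → ℂ => extendZero_apply u ⟨x, hx⟩
    simp only at h
    simp [h]
  · have hn : ¬ ∃ a : orthant d, (a : Euc d) = x := fun ⟨a, ha⟩ => hx (ha ▸ a.2)
    simp [extendZero, Function.extend_apply' _ _ _ hn]

theorem extendZero_smul {d : ℕ} (c : ℂ) (f : orthant d → ℂ) :
    extendZero (c • f) = c • extendZero f := by
  funext x
  by_cases hx : x ∈ orthant d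
  · have h := fun u : orthant d → ℂ => extendZero_apply u ⟨x, hx⟩
    simp only at h
    simp [h]
  · have hn : ¬ ∃ a : orthant d, (a : Euc d) = x := fun ⟨a, ha⟩ => hx (ha ▸ a.2)
    simp [extendZero, Function.extend_apply' _ _ _ hn]

theorem extendZero_zero {d : ℕ} : extendZero (0 : orthant d → ℂ) = 0 := by
  simpa using extendZero_smul (0 : ℂ) (0 : orthant d → ℂ)

theorem extendZero_eventuallyEq {d : ℕ} (F : Euc d → ℂ) {x : Euc d} (hx : x ∈ orthant d) :
    extendZero (fun y : orthant d => F y) =ᶠ[𝓝 x] F := by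
  filter_upwards [(isOpen_orthant d).mem_nhds hx] with y hy
  exact extendZero_apply (fun y : orthant d => F y) ⟨y, hy⟩

theorem monomial_nonneg {d : ℕ} (k : Fin d → ℕ) {x : Euc d} (hx : x ∈ orthant d) :
    0 ≤ monomial k x :=
  Finset.prod_nonneg fun i _ => pow_nonneg (hx i).le _

theorem IsSchwartz.contDiffAt {d : ℕ} {f : orthant d → ℂ} (hf : IsSchwartz f) (n : ℕ) {x : Euc d}
    (hx : x ∈ orthant d) : ContDiffAt ℝ n (extendZero f) x :=
  ((hf.smooth).contDiffAt ((isOpen_orthant d).mem_nhds hx)).of_le (by exact_mod_cast le_top)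

theorem IsSchwartz.partialDeriv_add {d : ℕ} {f g : orthant d → ℂ} (hf : IsSchwartz f)
    (hg : IsSchwartz g) (p : Fin d → ℕ) {x : Euc d} (hx : x ∈ orthant d) :
    partialDeriv p (extendZero (f + g)) x
      = partialDeriv p (extendZero f) x + partialDeriv p (extendZero g) x := by
  rw [extendZero_add]
  simp only [partialDeriv]
  rw [iteratedFDeriv_add_apply (hf.contDiffAt _ hx) (hg.contDiffAt _ hx)]
  rfl

theorem IsSchwartz.partialDeriv_smul {d : ℕ} {f : orthant d → ℂ} (hf : IsSchwartz f) (c : ℂ)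
    (p : Fin d → ℕ) {x : Euc d} (hx : x ∈ orthant d) :
    partialDeriv p (extendZero (c • f)) x = c • partialDeriv p (extendZero f) x := by
  rw [extendZero_smul]
  simp only [partialDeriv]
  rw [iteratedFDeriv_const_smul_apply (hf.contDiffAt _ hx)]
  rfl

theorem partialDeriv_zero {d : ℕ} (p : Fin d → ℕ) (x : Euc d) :
    partialDeriv p (extendZero (0 : orthant d → ℂ)) x = 0 := by
  rw [extendZero_zero, partialDeriv, iteratedFDeriv_zero]
  rfl

theorem IsSchwartz.zero {d : ℕ} : IsSchwartz (0 : orthant d → ℂ) where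
  smooth := by rw [extendZero_zero]; exact contDiffOn_const
  extends_continuously p := ⟨0, continuousOn_const, fun x _ => by rw [partialDeriv_zero]; rfl⟩
  decay k p := ⟨0, fun x _ => by simp [partialDeriv_zero]⟩

theorem IsSchwartz.add {d : ℕ} {f g : orthant d → ℂ} (hf : IsSchwartz f) (hg : IsSchwartz g) :
    IsSchwartz (f + g) where
  smooth := by rw [extendZero_add]; exact hf.smooth.add hg.smooth
  extends_continuously p := by
    obtain ⟨F, hF, hF1⟩ := hf.extends_continuously p
    obtain ⟨G, hG, hG1⟩ := hg.extends_continuously p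
    refine ⟨F + G, hF.add hG, fun x hx => ?_⟩
    rw [hf.partialDeriv_add hg p hx, Pi.add_apply, hF1 x hx, hG1 x hx]
  decay k p := by
    obtain ⟨C, hC⟩ := hf.decay k p
    obtain ⟨C', hC'⟩ := hg.decay k p
    refine ⟨C + C', fun x hx => ?_⟩
    rw [hf.partialDeriv_add hg p hx]
    calc _ ≤ monomial k x *
          (‖partialDeriv p (extendZero f) x‖ + ‖partialDeriv p (extendZero g) x‖) :=
          mul_le_mul_of_nonneg_left (norm_add_le _ _) (monomial_nonneg k hx)
      _ ≤ C + C' := by rw [mul_add]; exact add_le_add (hC x hx) (hC' x hx)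

theorem IsSchwartz.smul {d : ℕ} {f : orthant d → ℂ} (hf : IsSchwartz f) (c : ℂ) :
    IsSchwartz (c • f) where
  smooth := by rw [extendZero_smul]; exact contDiffOn_const.smul hf.smooth
  extends_continuously p := by
    obtain ⟨F, hF, hF1⟩ := hf.extends_continuously p
    refine ⟨c • F, hF.const_smul c, fun x hx => ?_⟩
    rw [hf.partialDeriv_smul c p hx, Pi.smul_apply, hF1 x hx]
  decay k p := by
    obtain ⟨C, hC⟩ := hf.decay k p
    refine ⟨‖c‖ * C, fun x hx => ?_⟩
    rw [hf.partialDeriv_smul c p hx, norm_smul, mul_left_comm]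
    exact mul_le_mul_of_nonneg_left (hC x hx) (norm_nonneg c)

/-- `𝓢(ℝ^d_+)` as a vector space of functions on the open orthant. -/
def schwartzSubmodule (d : ℕ) : Submodule ℂ (orthant d → ℂ) where
  carrier := {f | IsSchwartz f}
  add_mem' hf hg := IsSchwartz.add hf hg
  zero_mem' := IsSchwartz.zero
  smul_mem' c _ hf := IsSchwartz.smul hf c

/-- The space `𝓢(ℝ^d_+)`. This is a type of its own, so that it does not inherit the topology of
pointwise convergence from the function space; its topology is defined below by seminorms. -/
def Space (d : ℕ) : Type := schwartzSubmodule d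

instance instAddCommGroup (d : ℕ) : AddCommGroup (Space d) :=
  inferInstanceAs (AddCommGroup (schwartzSubmodule d))

instance instModule (d : ℕ) : Module ℂ (Space d) :=
  inferInstanceAs (Module ℂ (schwartzSubmodule d))

/-- The function on the open orthant underlying an element of `𝓢(ℝ^d_+)`. -/
def Space.toFun {d : ℕ} (f : Space d) : orthant d → ℂ := f.1

instance instCoeFun (d : ℕ) : CoeFun (Space d) (fun _ => orthant d → ℂ) := ⟨Space.toFun⟩

theorem Space.isSchwartz {d : ℕ} (f : Space d) : IsSchwartz f.toFun := f.2

theorem Space.toFun_add {d : ℕ} (f g : Space d) : (f + g).toFun = f.toFun + g.toFun := rfl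

theorem Space.toFun_smul {d : ℕ} (c : ℂ) (f : Space d) : (c • f).toFun = c • f.toFun := rfl

theorem Space.toFun_zero {d : ℕ} : (0 : Space d).toFun = 0 := rfl

theorem Space.bddAbove {d : ℕ} (f : Space d) (k p : Fin d → ℕ) :
    BddAbove (Set.range fun x : orthant d =>
      monomial k x * ‖partialDeriv p (extendZero f.toFun) x‖) := by
  obtain ⟨C, hC⟩ := f.isSchwartz.decay k p
  refine ⟨C, ?_⟩
  rintro _ ⟨x, rfl⟩
  exact hC x x.2

/-- The seminorm `sup_{x ∈ ℝ^d_+} x^k |D^p f(x)|` on `𝓢(ℝ^d_+)`. -/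
def seminorm {d : ℕ} (k p : Fin d → ℕ) : Seminorm ℂ (Space d) :=
  Seminorm.ofSMulLE
    (fun f => ⨆ x : orthant d, monomial k x * ‖partialDeriv p (extendZero f.toFun) x‖)
    (by simp [Space.toFun_zero, partialDeriv_zero])
    (fun f g => by
      refine ciSup_le fun x => ?_
      rw [Space.toFun_add, f.isSchwartz.partialDeriv_add g.isSchwartz p x.2]
      calc _ ≤ monomial k (x : Euc d) * (‖partialDeriv p (extendZero f.toFun) x‖
            + ‖partialDeriv p (extendZero g.toFun) x‖) :=
            mul_le_mul_of_nonneg_left (norm_add_le _ _) (monomial_nonneg k x.2)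
        _ ≤ _ := by
            rw [mul_add]
            exact add_le_add (le_ciSup (f.bddAbove k p) x) (le_ciSup (g.bddAbove k p) x))
    (fun c f => by
      refine ciSup_le fun x => ?_
      rw [Space.toFun_smul, f.isSchwartz.partialDeriv_smul c p x.2, norm_smul, mul_left_comm]
      exact mul_le_mul_of_nonneg_left (le_ciSup (f.bddAbove k p) x) (norm_nonneg c))

theorem seminorm_apply {d : ℕ} (k p : Fin d → ℕ) (f : Space d) :
    seminorm k p f
      = ⨆ x : orthant d, monomial k x * ‖partialDeriv p (extendZero f.toFun) x‖ := rfl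

/-- The family of all the seminorms above, indexed by pairs `(k, p)` of multi-indices. -/
def seminormFamily (d : ℕ) : SeminormFamily ℂ (Space d) ((Fin d → ℕ) × (Fin d → ℕ)) :=
  fun kp => seminorm kp.1 kp.2

/-- The locally convex topology of `𝓢(ℝ^d_+)` defined by the seminorms above. -/
instance instTopologicalSpace (d : ℕ) : TopologicalSpace (Space d) :=
  (seminormFamily d).moduleFilterBasis.topology

theorem withSeminorms (d : ℕ) : WithSeminorms (seminormFamily d) := ⟨rfl⟩

instance instIsTopologicalAddGroup (d : ℕ) : IsTopologicalAddGroup (Space d) :=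
  (withSeminorms d).topologicalAddGroup

instance instContinuousSMul (d : ℕ) : ContinuousSMul ℂ (Space d) :=
  (withSeminorms d).continuousSMul

theorem partialDeriv_restrict {d : ℕ} (F : Euc d → ℂ) (p : Fin d → ℕ) {x : Euc d}
    (hx : x ∈ orthant d) :
    partialDeriv p (extendZero fun y : orthant d => F y) x = partialDeriv p F x := by
  simp only [partialDeriv]
  rw [((extendZero_eventuallyEq F hx).iteratedFDeriv ℝ _).eq_of_nhds]

theorem abs_monomial_le {d : ℕ} (k : Fin d → ℕ) (x : Euc d) :
    |monomial k x| ≤ ‖x‖ ^ (∑ i, k i) := by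
  rw [monomial, Finset.abs_prod, ← Finset.prod_pow_eq_pow_sum]
  refine Finset.prod_le_prod (fun i _ => abs_nonneg _) fun i _ => ?_
  rw [abs_pow]
  exact pow_le_pow_left₀ (abs_nonneg _) (PiLp.norm_apply_le x i) _

theorem norm_partialDeriv_le {d : ℕ} (p : Fin d → ℕ) (F : Euc d → ℂ) (x : Euc d) :
    ‖partialDeriv p F x‖ ≤ ‖iteratedFDeriv ℝ (∑ i, p i) F x‖ := by
  refine (ContinuousMultilinearMap.le_opNorm _ _).trans (le_of_eq ?_)
  simp

theorem restrict_bound {d : ℕ} (f : 𝓢(Euc d, ℂ)) (k p : Fin d → ℕ) {x : Euc d}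
    (hx : x ∈ orthant d) :
    monomial k x * ‖partialDeriv p (extendZero fun y : orthant d => f y) x‖
      ≤ SchwartzMap.seminorm ℂ (∑ i, k i) (∑ i, p i) f := by
  rw [partialDeriv_restrict (fun y => f y) p hx]
  refine le_trans ?_ (SchwartzMap.le_seminorm ℂ (∑ i, k i) (∑ i, p i) f x)
  exact mul_le_mul ((le_abs_self _).trans (abs_monomial_le k x)) (norm_partialDeriv_le p _ x)
    (norm_nonneg _) (by positivity)

theorem isSchwartz_restrict {d : ℕ} (f : 𝓢(Euc d, ℂ)) :
    IsSchwartz (fun y : orthant d => f y) where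
  smooth := (f.smooth ⊤).contDiffOn.congr
    fun x hx => extendZero_apply (fun y : orthant d => f y) ⟨x, hx⟩
  extends_continuously p := by
    refine ⟨partialDeriv p f, Continuous.continuousOn ?_,
      fun x hx => (partialDeriv_restrict (fun y => f y) p hx).symm⟩
    have h : Continuous (iteratedFDeriv ℝ (∑ i, p i) f) :=
      (f.smooth (∑ i, p i : ℕ)).continuous_iteratedFDeriv le_rfl
    exact (ContinuousMultilinearMap.apply ℝ (fun _ => Euc d) ℂ _).continuous.comp h
  decay k p := ⟨_, fun _ hx => restrict_bound f k p hx⟩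

/-- The restriction `f ↦ f|_{ℝ^d_+}` from `𝓢(ℝ^d)` to `𝓢(ℝ^d_+)`. -/
def restrict (d : ℕ) : 𝓢(Euc d, ℂ) →ₗ[ℂ] Space d where
  toFun f := ⟨fun y : orthant d => f y, isSchwartz_restrict f⟩
  map_add' _ _ := rfl
  map_smul' _ _ := rfl

theorem restrict_apply {d : ℕ} (f : 𝓢(Euc d, ℂ)) (x : orthant d) : restrict d f x = f x := rfl

/-- The subspace `N` of the functions in `𝓢(ℝ^d)` with support in `ℝ^d \ ℝ^d_+`. -/
def nullSpace (d : ℕ) : Submodule ℂ 𝓢(Euc d, ℂ) where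
  carrier := {f | tsupport f ⊆ (orthant d)ᶜ}
  zero_mem' := by simp [tsupport]
  add_mem' {f g} hf hg := (tsupport_add f g).trans (Set.union_subset hf hg)
  smul_mem' c f hf := (tsupport_smul_subset_right (fun _ => c) f).trans hf

/-- The subspace of those tempered distributions on `ℝ^d` whose (distributional) support lies in the
closed orthant. `StrongDual` is the continuous dual with the topology of uniform convergence on
bounded sets. -/
def supportedDistributions (d : ℕ) : Submodule ℂ (StrongDual ℂ 𝓢(Euc d, ℂ)) where
  carrier := {T | Distribution.dsupport T ⊆ closure (orthant d)}
  zero_mem' := by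
    intro x hx
    exact absurd (fun u _ => rfl)
      ((Distribution.mem_dsupport_iff_not_isVanishingOn x).1 hx Set.univ trivial isOpen_univ)
  add_mem' {T S} hT hS := by
    intro x hx
    by_contra hn
    obtain ⟨s, hs, hso, hxs⟩ :=
      (Distribution.notMem_dsupport_iff x).1 (fun h => hn (hT h))
    obtain ⟨t, ht, hto, hxt⟩ :=
      (Distribution.notMem_dsupport_iff x).1 (fun h => hn (hS h))
    refine (Distribution.notMem_dsupport_iff x).2
      ⟨s ∩ t, fun u hu => ?_, hso.inter hto, hxs, hxt⟩ hx
    rw [add_apply, hs u (hu.trans Set.inter_subset_left),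
      ht u (hu.trans Set.inter_subset_right), add_zero]
  smul_mem' c T hT := by
    refine (Distribution.dsupport_subset_dsupport fun s _ hs u hu => ?_).trans hT
    rw [smul_apply, hs u hu, smul_zero]

end OrthantSchwartz

end

/-! Everything rests on a Seeley extension with estimates: each f in 𝓢(ℝ^d_+) has an extension s(f)
in 𝓢(ℝ^d) whose seminorms are bounded by finitely many seminorms of f (`exists_extension`). The
derivatives of f extend continuously to the closed orthant and form a jet there. The jet is
continued across one coordinate hyperplane after another by F(x', -y) = ∑ a_k f(x', 8^k y), with
rapidly decreasing a_k such that ∑ a_k (-8^k)^n = 1 for all n. These moment conditions make all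
derivatives match on the hyperplane. As 8^k ≥ 1, the reflected points are no closer to the origin,
so polynomial weights cost nothing.

Since R ∘ s = id and s tends to 0 at 0, R is open and onto; its kernel is N, which gives the
quotient statement. A distribution is supported in the closed orthant exactly when it annihilates N
(`mem_supportedDistributions_iff`): shifting a function in N along the diagonal moves its support
off the closed orthant, and the shifts converge back to it. Hence these distributions form a closed
subspace, and each factors through R. The inverse transpose is S ↦ S ∘ s, continuous for the strong
topologies because s preserves bounded sets. -/

noncomputable section

namespace OrthantSchwartz

/-! ### Seeley's reflection coefficients -/

/-- Coefficients with `∑ c_k 8^{kn} = 0` for all `n ≥ 1`. -/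
def eulerCoeff (k : ℕ) : ℝ := ∏ i ∈ Finset.range k, -(1 / ((8 : ℝ) ^ (i + 1) - 1))

theorem seven_le_pow_sub_one (k : ℕ) : (7 : ℝ) ≤ 8 ^ (k + 1) - 1 := by
  have h : (1 : ℝ) ≤ 8 ^ k := one_le_pow₀ (by norm_num)
  rw [pow_succ]; linarith

theorem eulerCoeff_succ (k : ℕ) :
    eulerCoeff (k + 1) = eulerCoeff k * -(1 / ((8 : ℝ) ^ (k + 1) - 1)) :=
  Finset.prod_range_succ _ _

theorem eulerCoeff_succ_mul (k : ℕ) :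
    eulerCoeff (k + 1) * 8 ^ (k + 1) = eulerCoeff (k + 1) - eulerCoeff k := by
  have h : ((8 : ℝ) ^ (k + 1) - 1) ≠ 0 := by linarith [seven_le_pow_sub_one k]
  rw [eulerCoeff_succ]; field_simp; ring

theorem eulerCoeff_ne_zero (k : ℕ) : eulerCoeff k ≠ 0 := by
  refine Finset.prod_ne_zero_iff.2 fun i _ => ?_
  have := seven_le_pow_sub_one i
  exact neg_ne_zero.2 (one_div_ne_zero (by linarith))

theorem abs_eulerCoeff_le (k : ℕ) : |eulerCoeff k| ≤ (1 / 7) ^ k := by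
  induction k with
  | zero => simp [eulerCoeff]
  | succ k ih =>
    have h := seven_le_pow_sub_one k
    rw [eulerCoeff_succ, abs_mul, pow_succ (1 / 7 : ℝ), abs_neg,
      abs_of_pos (one_div_pos.2 (show (0 : ℝ) < 8 ^ (k + 1) - 1 by linarith))]
    gcongr

/-- The ratio of consecutive terms is 8^n / (8^(k+1) - 1), which tends to 0 for every fixed n. -/
theorem summable_abs_eulerCoeff (n : ℕ) :
    Summable fun k => |eulerCoeff k| * ((8 : ℝ) ^ k) ^ n := by
  refine summable_of_ratio_test_tendsto_lt_one (l := 0) one_pos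
    (.of_forall fun k => mul_ne_zero (abs_ne_zero.2 (eulerCoeff_ne_zero k)) (by positivity)) ?_
  have h1 : Filter.Tendsto (fun k : ℕ => (8 : ℝ) ^ (k + 1) - 1) Filter.atTop Filter.atTop :=
    Filter.tendsto_atTop_add_const_right _ _
      ((tendsto_pow_atTop_atTop_of_one_lt (by norm_num)).comp (Filter.tendsto_add_atTop_nat 1))
  refine (h1.const_div_atTop ((8 : ℝ) ^ n)).congr fun k => ?_
  have h := seven_le_pow_sub_one k
  have h2 : |eulerCoeff k| ≠ 0 := abs_ne_zero.2 (eulerCoeff_ne_zero k)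
  have h3 : (0 : ℝ) < 8 ^ (k + 1) - 1 := by linarith
  rw [Real.norm_of_nonneg (by positivity), Real.norm_of_nonneg (by positivity), eulerCoeff_succ,
    abs_mul, abs_neg, abs_of_pos (one_div_pos.2 h3), pow_succ (8 : ℝ) k, mul_pow]
  rw [pow_succ] at h3
  field_simp

theorem summable_eulerCoeff (n : ℕ) : Summable fun k => eulerCoeff k * ((8 : ℝ) ^ k) ^ n :=
  .of_norm <| (summable_abs_eulerCoeff n).congr fun k => by
    rw [norm_mul, Real.norm_eq_abs, Real.norm_of_nonneg (by positivity)]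

/-- By `eulerCoeff_succ_mul` the moments S_n = ∑ c_k 8^(kn) satisfy S_(n+1) = (1 - 8^n) S_n. The
factor is 0 at n = 0, which kills every later moment. -/
theorem tsum_eulerCoeff_succ (n : ℕ) : ∑' k, eulerCoeff k * ((8 : ℝ) ^ k) ^ (n + 1) = 0 := by
  have key : ∀ n, ∑' k, eulerCoeff k * ((8 : ℝ) ^ k) ^ (n + 1)
      = (1 - 8 ^ n) * ∑' k, eulerCoeff k * ((8 : ℝ) ^ k) ^ n := by
    intro n
    have e : ∀ k, eulerCoeff (k + 1) * ((8 : ℝ) ^ (k + 1)) ^ (n + 1)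
        = eulerCoeff (k + 1) * ((8 : ℝ) ^ (k + 1)) ^ n
          - 8 ^ n * (eulerCoeff k * ((8 : ℝ) ^ k) ^ n) := by
      intro k
      rw [pow_succ, mul_comm (_ ^ n), ← mul_assoc, eulerCoeff_succ_mul, pow_succ (8 : ℝ) k, mul_pow]
      ring
    rw [(summable_eulerCoeff (n + 1)).tsum_eq_zero_add]
    simp_rw [e]
    rw [((summable_nat_add_iff 1).2 (summable_eulerCoeff n)).tsum_sub
      ((summable_eulerCoeff n).mul_left _), tsum_mul_left, sub_mul, one_mul,
      (summable_eulerCoeff n).tsum_eq_zero_add]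
    simp
    ring
  induction n with
  | zero => rw [key]; simp
  | succ n ih => rw [key, ih, mul_zero]

theorem eulerCoeff_div_abs_le (k : ℕ) : |eulerCoeff k * 8 ^ k / (1 + 8 ^ k)| ≤ |eulerCoeff k| := by
  rw [mul_div_assoc, abs_mul]
  refine mul_le_of_le_one_right (abs_nonneg _) ?_
  rw [abs_of_pos (by positivity), div_le_one (by positivity)]
  linarith

/-- The term k = 0 is 1/2, while the remaining terms add up to at most ∑ (1/7)^(k+1) = 1/6 in
absolute value. -/
theorem tsum_eulerCoeff_div_ne_zero : ∑' k, eulerCoeff k * 8 ^ k / (1 + 8 ^ k) ≠ 0 := by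
  have hs : Summable fun k => eulerCoeff k * 8 ^ k / (1 + 8 ^ k) :=
    .of_norm_bounded (by simpa using summable_abs_eulerCoeff 0) eulerCoeff_div_abs_le
  rw [hs.tsum_eq_zero_add]
  have hg := (hasSum_geometric_of_lt_one (r := (1 / 7 : ℝ)) (by norm_num) (by norm_num)).mul_left
    (1 / 7 : ℝ)
  have h := tsum_of_norm_bounded hg
    (f := fun k => eulerCoeff (k + 1) * 8 ^ (k + 1) / (1 + 8 ^ (k + 1))) fun k =>
      (eulerCoeff_div_abs_le (k + 1)).trans ((abs_eulerCoeff_le (k + 1)).trans_eq (pow_succ' _ _))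
  rw [Real.norm_eq_abs, abs_le] at h
  norm_num [eulerCoeff] at h ⊢
  intro h0
  linarith

/-- Seeley's reflection coefficients: all moments of `∑ a_k δ_{-8^k}` agree with those of `δ_1`. -/
theorem exists_reflectionCoeff : ∃ a : ℕ → ℝ,
    (∀ n : ℕ, Summable fun k => |a k| * ((8 : ℝ) ^ k) ^ n) ∧
    ∀ n : ℕ, ∑' k, a k * (-(8 : ℝ) ^ k) ^ n = 1 := by
  set A := ∑' k, eulerCoeff k * 8 ^ k / (1 + 8 ^ k) with hA
  have hA0 : A ≠ 0 := tsum_eulerCoeff_div_ne_zero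
  have hs : ∀ n, Summable fun k =>
      |A⁻¹ * (eulerCoeff k * 8 ^ k / (1 + 8 ^ k))| * ((8 : ℝ) ^ k) ^ n := by
    intro n
    refine .of_nonneg_of_le (fun k => by positivity) (fun k => ?_)
      ((summable_abs_eulerCoeff n).mul_left |A⁻¹|)
    rw [abs_mul, mul_assoc]
    exact mul_le_mul_of_nonneg_left (mul_le_mul_of_nonneg_right (eulerCoeff_div_abs_le k)
      (by positivity)) (abs_nonneg _)
  refine ⟨fun k => A⁻¹ * (eulerCoeff k * 8 ^ k / (1 + 8 ^ k)), hs, fun n => ?_⟩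
  have hs' : ∀ n, Summable fun k =>
      A⁻¹ * (eulerCoeff k * 8 ^ k / (1 + 8 ^ k)) * (-(8 : ℝ) ^ k) ^ n := fun n =>
    .of_norm <| (hs n).congr fun k => by
      rw [norm_mul, norm_pow, norm_neg, norm_pow, Real.norm_eq_abs,
        Real.norm_of_nonneg (by norm_num : (0 : ℝ) ≤ 8)]
  induction n with
  | zero =>
    simp only [pow_zero, mul_one]
    rw [tsum_mul_left, ← hA, inv_mul_cancel₀ hA0]
  | succ n ih =>
    -- Consecutive moments agree: the factor -8^k - 1 from the difference cancels the denominator 1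
    -- + 8^k and leaves a multiple of ∑ c_k 8^(k(n+1)) = 0.
    refine Eq.trans (sub_eq_zero.1 ?_) ih
    refine ((hs' _).tsum_sub (hs' _)).symm.trans ?_
    rw [← mul_zero (-A⁻¹ * (-1) ^ n), ← tsum_eulerCoeff_succ n, ← tsum_mul_left]
    refine tsum_congr fun k => ?_
    rw [pow_succ (-(8 : ℝ) ^ k), neg_pow, pow_succ ((8 : ℝ) ^ k)]
    field_simp
    ring

/-! ### Jets on sets that need not be open -/

section Jet

variable {E F : Type*} [NormedAddCommGroup E] [NormedSpace ℝ E]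
  [NormedAddCommGroup F] [NormedSpace ℝ F]

/-- A formal Taylor series which is the jet of a smooth function on the (arbitrary) set `s`. -/
def IsJet (p : E → FormalMultilinearSeries ℝ E F) (s : Set E) : Prop :=
  HasFTaylorSeriesUpToOn ∞ (fun x => (p x 0).curry0) p s

theorem IsJet.hasFDerivWithinAt {p : E → FormalMultilinearSeries ℝ E F} {s : Set E}
    (hp : IsJet p s) (n : ℕ) {x : E} (hx : x ∈ s) :
    HasFDerivWithinAt (fun y => p y n) (p x (n + 1)).curryLeft s x :=
  hp.fderivWithin n (by exact_mod_cast ENat.natCast_lt_top n) x hx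

theorem isJet_of_hasFDerivWithinAt {p : E → FormalMultilinearSeries ℝ E F} {s : Set E}
    (h : ∀ n, ∀ x ∈ s, HasFDerivWithinAt (fun y => p y n) (p x (n + 1)).curryLeft s x) :
    IsJet p s where
  zero_eq _ _ := rfl
  fderivWithin n _ x hx := h n x hx
  cont n _ x hx := (h n x hx).continuousWithinAt

theorem norm_curryLeft_sub {n : ℕ} (f g : ContinuousMultilinearMap ℝ (fun _ : Fin (n + 1) => E) F) :
    ‖f.curryLeft - g.curryLeft‖ = ‖f - g‖ :=
  ContinuousMultilinearMap.curryLeft_norm (f - g)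

theorem IsJet.norm_sub_le {p : E → FormalMultilinearSeries ℝ E F} {s : Set E}
    (hp : IsJet p s) (hs : Convex ℝ s) {n : ℕ} {C : ℝ} (hC : ∀ x ∈ s, ‖p x (n + 1)‖ ≤ C)
    {x y : E} (hx : x ∈ s) (hy : y ∈ s) : ‖p y n - p x n‖ ≤ C * ‖y - x‖ :=
  Convex.norm_image_sub_le_of_norm_hasFDerivWithin_le (𝕜 := ℝ) (f := fun y => p y n)
    (fun _ hz => hp.hasFDerivWithinAt n hz)
    (fun z hz => (ContinuousMultilinearMap.curryLeft_norm _).trans_le (hC z hz)) hs hx hy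

theorem IsJet.norm_sub_sub_le {p : E → FormalMultilinearSeries ℝ E F} {s : Set E}
    (hp : IsJet p s) (hs : Convex ℝ s) {n : ℕ} {C : ℝ} (hC : ∀ x ∈ s, ‖p x (n + 2)‖ ≤ C)
    {x y : E} (hx : x ∈ s) (hy : y ∈ s) :
    ‖p y n - p x n - (p x (n + 1)).curryLeft (y - x)‖ ≤ C * ‖y - x‖ ^ 2 := by
  have hC0 : 0 ≤ C := (norm_nonneg _).trans (hC x hx)
  have hseg : segment ℝ x y ⊆ s := hs.segment_subset hx hy
  rw [pow_two, ← mul_assoc]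
  refine Convex.norm_image_sub_le_of_norm_hasFDerivWithin_le' (𝕜 := ℝ) (f := fun y => p y n)
    (fun z hz => (hp.hasFDerivWithinAt n (hseg hz)).mono hseg) (fun z hz => ?_)
    (convex_segment x y) (left_mem_segment ℝ x y) (right_mem_segment ℝ x y)
  rw [norm_curryLeft_sub]
  refine (hp.norm_sub_le hs hC hx (hseg hz)).trans ?_
  gcongr
  obtain ⟨a, b, ha, hb, hab, rfl⟩ := hz
  have : a • x + b • y - x = b • (y - x) := by
    rw [eq_sub_iff_add_eq.2 hab]; module
  rw [this, norm_smul, Real.norm_of_nonneg hb]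
  exact mul_le_of_le_one_left (norm_nonneg _) (by linarith)

/-- On a convex set the first-order Taylor remainder of each term is at most its bound for order n +
2 times ‖y - x‖². These bounds are summable, so the remainder of the sum is quadratic too. The
argument works at boundary points, where only derivatives within the set make sense. -/
theorem isJet_tsum [CompleteSpace F] {q : ℕ → E → FormalMultilinearSeries ℝ E F} {s : Set E}
    (hs : Convex ℝ s) (hq : ∀ k, IsJet (q k) s) {u : ℕ → ℕ → ℝ} (hu : ∀ n, Summable (u n))
    (hb : ∀ n k, ∀ x ∈ s, ‖q k x n‖ ≤ u n k) : IsJet (fun x n => ∑' k, q k x n) s := by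
  have hsum : ∀ n, ∀ x ∈ s, Summable fun k => q k x n := fun n x hx =>
    .of_norm_bounded (hu n) fun k => hb n k x hx
  refine isJet_of_hasFDerivWithinAt fun n x hx => ?_
  rw [hasFDerivWithinAt_iff_isLittleO]
  refine Asymptotics.IsBigO.trans_isLittleO (g := fun y => ‖y - x‖ ^ 2) ?_
    ((Asymptotics.isLittleO_pow_sub_sub x one_lt_two).mono nhdsWithin_le_nhds)
  refine Asymptotics.IsBigO.of_bound (∑' k, u (n + 2) k) ?_
  filter_upwards [self_mem_nhdsWithin] with y hy
  let Φ : ContinuousMultilinearMap ℝ (fun _ : Fin (n + 1) => E) F →L[ℝ]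
      ContinuousMultilinearMap ℝ (fun _ : Fin n => E) F :=
    (ContinuousLinearMap.apply ℝ _ (y - x)).comp
      (continuousMultilinearCurryLeftEquiv ℝ (fun _ : Fin (n + 1) => E)
        F).toContinuousLinearEquiv.toContinuousLinearMap
  have e1 : (∑' k, q k x (n + 1)).curryLeft (y - x)
      = ∑' k, (q k x (n + 1)).curryLeft (y - x) := Φ.map_tsum (hsum _ x hx)
  have e2 : Summable fun k => (q k x (n + 1)).curryLeft (y - x) := Φ.summable (hsum _ x hx)
  rw [e1, ← (hsum n y hy).tsum_sub (hsum n x hx),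
    ← ((hsum n y hy).sub (hsum n x hx)).tsum_sub e2, norm_pow, norm_norm, ← tsum_mul_right]
  exact tsum_of_norm_bounded ((hu (n + 2)).mul_right _).hasSum fun k =>
    (hq k).norm_sub_sub_le hs (hb (n + 2) k) hx hy

open Classical in
-- A derivative within s and the same derivative within t give one within s ∪ t. At a point outside
-- one of the closed sets, the condition within that set is vacuous.
theorem IsJet.union {p q : E → FormalMultilinearSeries ℝ E F} {s t : Set E}
    (hp : IsJet p s) (hq : IsJet q t) (hs : IsClosed s) (ht : IsClosed t)
    (h : ∀ x ∈ s ∩ t, p x = q x) : IsJet (s.piecewise p q) (s ∪ t) := by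
  have e1 : ∀ x ∈ s, s.piecewise p q x = p x := fun x hx => Set.piecewise_eq_of_mem _ _ _ hx
  have e2 : ∀ x ∈ t, s.piecewise p q x = q x := fun x hx => by
    by_cases hxs : x ∈ s
    · rw [e1 x hxs, h x ⟨hxs, hx⟩]
    · exact Set.piecewise_eq_of_notMem _ _ _ hxs
  have d1 : ∀ n, ∀ x ∈ s, HasFDerivWithinAt (fun y => s.piecewise p q y n)
      (s.piecewise p q x (n + 1)).curryLeft s x := fun n x hx => by
    rw [e1 x hx]
    exact (hp.hasFDerivWithinAt n hx).congr (fun y hy => by rw [e1 y hy]) (by rw [e1 x hx])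
  have d2 : ∀ n, ∀ x ∈ t, HasFDerivWithinAt (fun y => s.piecewise p q y n)
      (s.piecewise p q x (n + 1)).curryLeft t x := fun n x hx => by
    rw [e2 x hx]
    exact (hq.hasFDerivWithinAt n hx).congr (fun y hy => by rw [e2 y hy]) (by rw [e2 x hx])
  have far : ∀ {u : Set E}, IsClosed u → ∀ n, ∀ x ∉ u, HasFDerivWithinAt
      (fun y => s.piecewise p q y n) (s.piecewise p q x (n + 1)).curryLeft u x :=
    fun hu n x hx => .of_notMem_closure (by rwa [hu.closure_eq])
  refine isJet_of_hasFDerivWithinAt fun n x _ => HasFDerivWithinAt.union ?_ ?_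
  · by_cases hx : x ∈ s
    · exact d1 n x hx
    · exact far hs n x hx
  · by_cases hx : x ∈ t
    · exact d2 n x hx
    · exact far ht n x hx

theorem IsJet.compContinuousLinearMap {p : E → FormalMultilinearSeries ℝ E F} {s t : Set E}
    (hp : IsJet p s) (g : E →L[ℝ] E) (hg : Set.MapsTo g t s) (c : ℝ) :
    IsJet (fun x n => c • (p (g x) n).compContinuousLinearMap fun _ => g) t := by
  refine isJet_of_hasFDerivWithinAt fun n x hx => ?_
  have h := (HasFTaylorSeriesUpToOn.compContinuousLinearMap hp g).mono hg |>.fderivWithin n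
    (by exact_mod_cast ENat.natCast_lt_top n) x hx
  exact h.fun_const_smul c

end Jet

/-! ### Reflection across coordinate hyperplanes -/

/-- The linear map which multiplies the `j`-th coordinate by `c`. -/
def stretch {d : ℕ} (j : Fin d) (c : ℝ) : Euc d →L[ℝ] Euc d :=
  .id ℝ _ + (c - 1) • (EuclideanSpace.proj (𝕜 := ℝ) j).smulRight (EuclideanSpace.single j (1 : ℝ))

theorem stretch_apply {d : ℕ} (j : Fin d) (c : ℝ) (x : Euc d) :
    stretch j c x = x + ((c - 1) * x j) • EuclideanSpace.single j (1 : ℝ) := by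
  simp [stretch, mul_smul]

theorem stretch_apply_self {d : ℕ} (j : Fin d) (c : ℝ) (x : Euc d) :
    stretch j c x j = c * x j := by
  simp [stretch_apply]; ring

theorem stretch_apply_of_ne {d : ℕ} {i j : Fin d} (h : i ≠ j) (c : ℝ) (x : Euc d) :
    stretch j c x i = x i := by
  simp [stretch_apply, h]

theorem stretch_of_apply_eq_zero {d : ℕ} {j : Fin d} (c : ℝ) {x : Euc d} (hx : x j = 0) :
    stretch j c x = x := by
  simp [stretch_apply, hx]

theorem norm_stretch_le {d : ℕ} (j : Fin d) (c : ℝ) : ‖stretch j c‖ ≤ 1 + |c - 1| := by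
  refine ContinuousLinearMap.opNorm_le_bound _ (by positivity) fun x => ?_
  rw [stretch_apply, add_mul, one_mul]
  refine (norm_add_le _ _).trans (add_le_add_right ?_ _)
  rw [norm_smul, norm_mul, Real.norm_eq_abs, PiLp.norm_single, norm_one, mul_one]
  gcongr
  exact PiLp.norm_apply_le x j

theorem norm_le_norm_stretch {d : ℕ} (j : Fin d) {c : ℝ} (hc : 1 ≤ |c|) (x : Euc d) :
    ‖x‖ ≤ ‖stretch j c x‖ := by
  rw [EuclideanSpace.norm_eq, EuclideanSpace.norm_eq]
  refine Real.sqrt_le_sqrt (Finset.sum_le_sum fun i _ => ?_)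
  by_cases h : i = j
  · subst h
    rw [stretch_apply_self, norm_mul, Real.norm_eq_abs c]
    gcongr
    exact le_mul_of_one_le_left (norm_nonneg _) hc
  · rw [stretch_apply_of_ne h]

/-- Since `stretch j t` is affine in t, multilinearity makes M(stretch v) a polynomial in t. The
moment conditions say that ∑ a_k P(c_k) = P(1) for every polynomial P, and `stretch j 1` is the
identity. -/
theorem hasSum_comp_stretch {d n : ℕ} {F : Type*} [NormedAddCommGroup F] [NormedSpace ℝ F]
    (j : Fin d) (M : ContinuousMultilinearMap ℝ (fun _ : Fin n => Euc d) F) {a c : ℕ → ℝ}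
    (h : ∀ n, HasSum (fun k => a k * c k ^ n) 1) (v : Fin n → Euc d) :
    HasSum (fun k => a k • M fun i => stretch j (c k) (v i)) (M v) := by
  -- Split each vector into its e_j part u, which is scaled by t, and the rest w, which is fixed.
  let u : Fin n → Euc d := fun i => v i j • EuclideanSpace.single j (1 : ℝ)
  let w : Fin n → Euc d := v - u
  have key : ∀ t : ℝ, (M fun i => stretch j t (v i))
      = ∑ s : Finset (Fin n), t ^ s.card • M (s.piecewise u w) := by
    intro t
    have e : (fun i => stretch j t (v i)) = (t • u) + w := by
      funext i
      simp only [stretch_apply, Pi.add_apply, Pi.smul_apply, Pi.sub_apply, w, u]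
      module
    rw [e, M.map_add_univ]
    refine Finset.sum_congr rfl fun s _ => ?_
    have e2 : s.piecewise (t • u) w
        = s.piecewise (fun i => t • s.piecewise u w i) (s.piecewise u w) := by
      funext i
      by_cases hi : i ∈ s <;> simp [hi]
    rw [e2]
    refine (M.map_piecewise_smul (fun _ => t) _ s).trans ?_
    rw [Finset.prod_const]
  have h1 : M v = ∑ s : Finset (Fin n), (1 : ℝ) • M (s.piecewise u w) := by
    have := key 1
    simp only [one_pow] at this
    rw [← this]
    congr 1
    funext i
    simp [stretch_apply]
  rw [h1]
  simp_rw [key, Finset.smul_sum, smul_smul]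
  exact hasSum_sum fun s _ => (h s.card).smul_const _

/-- The closed cone of the points whose coordinates with index in `J` are nonnegative. -/
def nonnegCone {d : ℕ} (J : Finset (Fin d)) : Set (Euc d) := {x | ∀ i ∈ J, 0 ≤ x i}

theorem convex_nonnegCone {d : ℕ} (J : Finset (Fin d)) : Convex ℝ (nonnegCone J) := by
  intro x hx y hy a b ha hb _ i hi
  simpa using add_nonneg (mul_nonneg ha (hx i hi)) (mul_nonneg hb (hy i hi))

theorem isClosed_nonnegCone {d : ℕ} (J : Finset (Fin d)) : IsClosed (nonnegCone J) := by
  simp only [nonnegCone, Set.ofPred_forall]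
  refine isClosed_iInter fun i => isClosed_iInter fun _ => isClosed_le continuous_const ?_
  fun_prop

/-- On x_j ≤ 0 the new jet is the sum of the pullbacks of p under x_j ↦ -8^k x_j, weighted by a_k.
Pulling back costs (3·8^k)^n at order n, still summable against |a_k|. The constant depends on n
alone because the stretches do not decrease ‖x‖. -/
theorem exists_jet_reflection (d : ℕ) (F : Type*) [NormedAddCommGroup F] [NormedSpace ℝ F]
    [CompleteSpace F] : ∃ C : ℕ → ℝ,
    ∀ (J : Finset (Fin d)) (j : Fin d) (p : Euc d → FormalMultilinearSeries ℝ (Euc d) F),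
      IsJet p (nonnegCone (insert j J)) →
      (∀ n, ∃ B, ∀ x ∈ nonnegCone (insert j J), ‖p x n‖ ≤ B) →
      ∃ p' : Euc d → FormalMultilinearSeries ℝ (Euc d) F,
        IsJet p' (nonnegCone J) ∧ (∀ x ∈ nonnegCone (insert j J), p' x = p x) ∧
        ∀ (k n : ℕ) (M : ℝ), (∀ x ∈ nonnegCone (insert j J), ‖x‖ ^ k * ‖p x n‖ ≤ M) →
          ∀ x ∈ nonnegCone J, ‖x‖ ^ k * ‖p' x n‖ ≤ C n * M := by
  classical
  obtain ⟨a, ha, hm⟩ := exists_reflectionCoeff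
  have hm' : ∀ n, HasSum (fun k => a k * (-(8 : ℝ) ^ k) ^ n) 1 := fun n => by
    rw [← hm n]
    exact (Summable.of_norm ((ha n).congr fun k => by
      rw [norm_mul, norm_pow, norm_neg, norm_pow, Real.norm_eq_abs,
        Real.norm_of_nonneg (by norm_num : (0 : ℝ) ≤ 8)])).hasSum
  -- Here 1 + |-8^k - 1| = 2 + 8^k ≤ 3·8^k.
  have hL : ∀ (j : Fin d) k, ‖stretch j (-(8 : ℝ) ^ k)‖ ≤ 3 * 8 ^ k := by
    intro j k
    refine (norm_stretch_le j _).trans ?_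
    have h1 : (1 : ℝ) ≤ 8 ^ k := one_le_pow₀ (by norm_num)
    rw [abs_of_neg (by linarith)]
    linarith
  have hu : ∀ n, Summable fun k => |a k| * (3 * (8 : ℝ) ^ k) ^ n := fun n =>
    ((ha n).mul_left (3 ^ n)).congr fun k => by rw [mul_pow]; ring
  -- The 1 serves the half where the jet is unchanged, the sum serves the reflected half.
  refine ⟨fun n => max 1 (∑' k, |a k| * (3 * (8 : ℝ) ^ k) ^ n), fun J j p hp hB => ?_⟩
  choose B hB using hB
  set s := nonnegCone (insert j J) with hs
  set t : Set (Euc d) := nonnegCone J ∩ {x | x j ≤ 0} with ht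
  have htc : Convex ℝ t := (convex_nonnegCone J).inter fun x hx y hy α β hα hβ _ => by
    simpa using add_nonpos (mul_nonpos_of_nonneg_of_nonpos hα hx)
      (mul_nonpos_of_nonneg_of_nonpos hβ hy)
  have htcl : IsClosed t := (isClosed_nonnegCone J).inter (isClosed_le (by fun_prop) (by fun_prop))
  have hst : s ∪ t = nonnegCone J := by
    ext x
    simp only [hs, ht, nonnegCone, Set.mem_union, Set.mem_inter_iff, Set.mem_ofPred_eq,
      Finset.forall_mem_insert]
    rcases le_total 0 (x j) with h | h <;> tauto
  have hmaps : ∀ k : ℕ, Set.MapsTo (stretch j (-(8 : ℝ) ^ k)) t s := by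
    intro k x hx i hi
    by_cases hij : i = j
    · subst hij
      rw [stretch_apply_self]
      exact mul_nonneg_of_nonpos_of_nonpos (neg_nonpos.2 (by positivity)) hx.2
    · rw [stretch_apply_of_ne hij]
      exact hx.1 i (Finset.mem_of_mem_insert_of_ne hi hij)
  let q : ℕ → Euc d → FormalMultilinearSeries ℝ (Euc d) F := fun k x n =>
    a k • (p (stretch j (-(8 : ℝ) ^ k) x) n).compContinuousLinearMap
      fun _ => stretch j (-(8 : ℝ) ^ k)
  have hq0 : ∀ k n x, ‖q k x n‖
      ≤ |a k| * (3 * (8 : ℝ) ^ k) ^ n * ‖p (stretch j (-(8 : ℝ) ^ k) x) n‖ := by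
    intro k n x
    simp only [q]
    rw [norm_smul, Real.norm_eq_abs, mul_assoc]
    gcongr
    refine (ContinuousMultilinearMap.norm_compContinuousLinearMap_le _ _).trans ?_
    rw [Finset.prod_const, Finset.card_univ, Fintype.card_fin, mul_comm]
    gcongr
    exact hL j k
  have hqB : ∀ n k, ∀ x ∈ t, ‖q k x n‖ ≤ |a k| * (3 * (8 : ℝ) ^ k) ^ n * B n := by
    intro n k x hx
    refine (hq0 k n x).trans ?_
    gcongr
    exact hB n _ (hmaps k hx)
  have hqs : ∀ n, ∀ x ∈ t, Summable fun k => q k x n := fun n x hx =>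
    .of_norm_bounded ((hu n).mul_right _) fun k => hqB n k x hx
  let Q : Euc d → FormalMultilinearSeries ℝ (Euc d) F := fun x n => ∑' k, q k x n
  have hQ : IsJet Q t :=
    isJet_tsum htc (fun k => hp.compContinuousLinearMap _ (hmaps k) _)
      (fun n => (hu n).mul_right (B n)) hqB
  -- On the hyperplane x_j = 0 every stretch fixes x and acts only on the arguments of the
  -- multilinear maps, so the moment identity applies.
  have hagree : ∀ x ∈ s ∩ t, p x = Q x := by
    intro x hx
    have hxj : x j = 0 := le_antisymm hx.2.2 (hx.1 j (Finset.mem_insert_self _ _))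
    funext n
    ext v
    have e := (ContinuousMultilinearMap.apply ℝ (fun _ : Fin n => Euc d) F v).map_tsum
      (hqs n x hx.2)
    refine Eq.trans ?_ e.symm
    have h := hasSum_comp_stretch j (p x n) hm' v
    rw [← h.tsum_eq]
    refine tsum_congr fun k => ?_
    simp [q, stretch_of_apply_eq_zero _ hxj]
  refine ⟨s.piecewise p Q, ?_, fun x hx => Set.piecewise_eq_of_mem _ _ _ hx,
    fun k n M hM x hx => ?_⟩
  · rw [← hst]
    exact hp.union hQ (isClosed_nonnegCone _) htcl hagree
  · have hM0 : 0 ≤ M := le_trans (by positivity) (hM 0 fun i _ => le_rfl)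
    by_cases hxs : x ∈ s
    · rw [show s.piecewise p Q x = p x from Set.piecewise_eq_of_mem _ _ _ hxs]
      exact (hM x hxs).trans (le_mul_of_one_le_left hM0 (le_max_left _ _))
    · rw [show s.piecewise p Q x = Q x from Set.piecewise_eq_of_notMem _ _ _ hxs]
      have hxt : x ∈ t := by
        rw [← hst] at hx
        exact hx.resolve_left hxs
      refine le_trans ?_ (mul_le_mul_of_nonneg_right (le_max_right _ _) hM0)
      rw [← norm_norm x, ← norm_pow, ← norm_smul, ← (hqs n x hxt).tsum_const_smul,
        ← tsum_mul_right]
      refine tsum_of_norm_bounded ((hu n).mul_right _).hasSum fun i => ?_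
      rw [norm_smul, norm_pow, norm_norm]
      calc ‖x‖ ^ k * ‖q i x n‖
          ≤ ‖x‖ ^ k * (|a i| * (3 * (8 : ℝ) ^ i) ^ n * ‖p (stretch j (-(8 : ℝ) ^ i) x) n‖) := by
            gcongr; exact hq0 i n x
        _ = |a i| * (3 * (8 : ℝ) ^ i) ^ n * (‖x‖ ^ k * ‖p (stretch j (-(8 : ℝ) ^ i) x) n‖) := by
            ring
        _ ≤ |a i| * (3 * (8 : ℝ) ^ i) ^ n * (‖stretch j (-(8 : ℝ) ^ i) x‖ ^ k
              * ‖p (stretch j (-(8 : ℝ) ^ i) x) n‖) := by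
            gcongr
            refine norm_le_norm_stretch j ?_ x
            rw [abs_neg, abs_of_pos (by positivity)]
            exact one_le_pow₀ (by norm_num)
        _ ≤ _ := by
            gcongr
            exact hM _ (hmaps i hxt)

/-- Induction on J removes one sign constraint per reflection, and the constants multiply. The
estimate with k = 0 supplies the boundedness required by the next reflection. -/
theorem exists_jet_extension {d : ℕ} (F : Type*) [NormedAddCommGroup F] [NormedSpace ℝ F]
    [CompleteSpace F] (J : Finset (Fin d)) : ∃ C : ℕ → ℝ,
    ∀ p : Euc d → FormalMultilinearSeries ℝ (Euc d) F,
      IsJet p (nonnegCone J) → (∀ n, ∃ B, ∀ x ∈ nonnegCone J, ‖p x n‖ ≤ B) →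
      ∃ p' : Euc d → FormalMultilinearSeries ℝ (Euc d) F,
        IsJet p' Set.univ ∧ (∀ x ∈ nonnegCone J, p' x = p x) ∧
        ∀ (k n : ℕ) (M : ℝ), (∀ x ∈ nonnegCone J, ‖x‖ ^ k * ‖p x n‖ ≤ M) →
          ∀ x, ‖x‖ ^ k * ‖p' x n‖ ≤ C n * M := by
  classical
  obtain ⟨D, hD⟩ := exists_jet_reflection d F
  induction J using Finset.induction_on with
  | empty =>
    have h : nonnegCone (∅ : Finset (Fin d)) = Set.univ := by ext; simp [nonnegCone]
    refine ⟨1, fun p hp _ => ⟨p, h ▸ hp, fun _ _ => rfl, fun k n M hM x => ?_⟩⟩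
    simpa using hM x (h ▸ Set.mem_univ x)
  | insert j J _ ih =>
    obtain ⟨C, hC⟩ := ih
    refine ⟨fun n => C n * D n, fun p hp hB => ?_⟩
    obtain ⟨q, hq, hqp, hqb⟩ := hD J j p hp hB
    obtain ⟨r, hr, hrq, hrb⟩ := hC q hq fun n => by
      obtain ⟨B, hB⟩ := hB n
      refine ⟨D n * B, fun x hx => ?_⟩
      simpa using hqb 0 n B (by simpa using hB) x hx
    refine ⟨r, hr, fun x hx => ?_, fun k n M hM x => ?_⟩
    · rw [hrq x fun i hi => hx i (Finset.mem_insert_of_mem hi), hqp x hx]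
    · rw [mul_assoc]
      exact hrb k n _ (hqb k n M hM) x

/-! ### Jets up to the boundary and iterated directional derivatives -/

section General

variable {E F : Type*} [NormedAddCommGroup E] [NormedSpace ℝ E]
  [NormedAddCommGroup F] [NormedSpace ℝ F]

/-- Each derivative is Lipschitz on the convex set U because the next one is bounded, so it extends
continuously to the closure. The extensions remain derivatives of one another at boundary points
because the derivatives converge there. -/
theorem exists_jet_closure [CompleteSpace F] {U : Set E} (hU : IsOpen U) (hc : Convex ℝ U)
    {f : E → F} (hf : ContDiffOn ℝ ∞ f U)
    (hb : ∀ n, ∃ B, ∀ x ∈ U, ‖iteratedFDeriv ℝ n f x‖ ≤ B) :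
    ∃ p : E → FormalMultilinearSeries ℝ E F, IsJet p (closure U) ∧
      ∀ x ∈ U, ∀ n, p x n = iteratedFDeriv ℝ n f x := by
  have hdiff : ∀ n, ∀ x ∈ U, DifferentiableAt ℝ (iteratedFDeriv ℝ n f) x := fun n x hx =>
    (hf.contDiffAt (hU.mem_nhds hx)).differentiableAt_iteratedFDeriv
      (by exact_mod_cast ENat.natCast_lt_top n)
  have hcont : ∀ n, ContinuousOn (iteratedFDeriv ℝ n f) U := fun n x hx =>
    (hdiff n x hx).continuousAt.continuousWithinAt
  have hfd : ∀ n, ∀ x ∈ U, fderiv ℝ (iteratedFDeriv ℝ n f) x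
      = (iteratedFDeriv ℝ (n + 1) f x).curryLeft := fun n x _ => by
    ext v w
    rw [ContinuousMultilinearMap.curryLeft_apply, iteratedFDeriv_succ_apply_left]
    simp
  have hlip : ∀ n, UniformContinuousOn (iteratedFDeriv ℝ n f) U := by
    intro n
    obtain ⟨B, hB⟩ := hb (n + 1)
    refine (LipschitzOnWith.of_dist_le_mul (K := B.toNNReal) fun x hx y hy => ?_).uniformContinuousOn
    rw [dist_eq_norm, dist_eq_norm]
    refine hc.norm_image_sub_le_of_norm_fderiv_le (𝕜 := ℝ) (fun z hz => hdiff n z hz)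
      (fun z hz => ?_) hy hx
    rw [hfd n z hz, ContinuousMultilinearMap.curryLeft_norm]
    exact (hB z hz).trans (Real.le_coe_toNNReal B)
  have hlim : ∀ n, ∀ x ∈ closure U, ∃ y, Filter.Tendsto (iteratedFDeriv ℝ n f) (𝓝[U] x) (𝓝 y) := by
    intro n x hx
    have : (𝓝[U] x).NeBot := mem_closure_iff_nhdsWithin_neBot.1 hx
    exact CompleteSpace.complete (Cauchy.map_of_le (cauchy_nhds.mono nhdsWithin_le_nhds) (hlip n)
      (Filter.le_principal_iff.2 self_mem_nhdsWithin))
  let p : E → FormalMultilinearSeries ℝ E F := fun x n => extendFrom U (iteratedFDeriv ℝ n f) x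
  have hpU : ∀ x ∈ U, ∀ n, p x n = iteratedFDeriv ℝ n f x := fun x hx n =>
    extendFrom_extends (hcont n) x hx
  have hpc : ∀ n, ContinuousOn (fun x => p x n) (closure U) := fun n =>
    continuousOn_extendFrom subset_rfl (hlim n)
  have hpe : ∀ n, ∀ x ∈ U, (fun y => p y n) =ᶠ[𝓝 x] iteratedFDeriv ℝ n f := fun n x hx => by
    filter_upwards [hU.mem_nhds hx] with y hy using hpU y hy n
  refine ⟨p, isJet_of_hasFDerivWithinAt fun n x hx => ?_, hpU⟩
  refine hasFDerivWithinAt_closure_of_tendsto_fderiv (fun y hy =>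
      ((hdiff n y hy).congr_of_eventuallyEq (hpe n y hy)).differentiableWithinAt) hc hU
    (fun y hy => (hpc n y hy).mono subset_closure) ?_
  have h1 : Filter.Tendsto (fun y => (p y (n + 1)).curryLeft) (𝓝[U] x)
      (𝓝 (p x (n + 1)).curryLeft) :=
    ((continuousMultilinearCurryLeftEquiv ℝ (fun _ : Fin (n + 1) => E) F).continuous.tendsto _).comp
      ((hpc (n + 1) x hx).mono subset_closure)
  refine h1.congr' ?_
  filter_upwards [self_mem_nhdsWithin] with y hy
  rw [(hpe n y hy).fderiv_eq, hfd n y hy, hpU y hy]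

/-- The iterated directional derivative of `f` along a list of vectors. -/
def iterLineDeriv (f : E → F) : List E → E → F
  | [] => f
  | v :: l => fun x => fderiv ℝ (iterLineDeriv f l) x v

theorem contDiffOn_iterLineDeriv {U : Set E} (hU : IsOpen U) {f : E → F}
    (hf : ContDiffOn ℝ ∞ f U) (l : List E) : ContDiffOn ℝ ∞ (iterLineDeriv f l) U := by
  induction l with
  | nil => exact hf
  | cons v l ih => exact (ih.fderiv_of_isOpen hU (by simp)).clm_apply contDiffOn_const

theorem iteratedFDeriv_eq_iterLineDeriv {U : Set E} (hU : IsOpen U) {f : E → F}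
    (hf : ContDiffOn ℝ ∞ f U) {n : ℕ} (v : Fin n → E) {x : E} (hx : x ∈ U) :
    iteratedFDeriv ℝ n f x v = iterLineDeriv f (List.ofFn v) x := by
  induction n generalizing x with
  | zero => simp [iterLineDeriv]
  | succ n ih =>
    rw [iteratedFDeriv_succ_apply_left, List.ofFn_succ]
    have h : iterLineDeriv f (List.ofFn (Fin.tail v)) =ᶠ[𝓝 x]
        fun y => iteratedFDeriv ℝ n f y (Fin.tail v) := by
      filter_upwards [hU.mem_nhds hx] with y hy using (ih _ hy).symm
    change _ = fderiv ℝ (iterLineDeriv f (List.ofFn (Fin.tail v))) x (v 0)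
    rw [h.fderiv_eq]
    have hd : DifferentiableAt ℝ (iteratedFDeriv ℝ n f) x :=
      (hf.contDiffAt (hU.mem_nhds hx)).differentiableAt_iteratedFDeriv
        (by exact_mod_cast ENat.natCast_lt_top n)
    have := (ContinuousMultilinearMap.apply ℝ (fun _ : Fin n => E) F
      (Fin.tail v)).hasFDerivAt.comp x hd.hasFDerivAt
    exact (congrArg (fun T : E →L[ℝ] F => T (v 0)) this.fderiv).symm

/-- Adjacent swaps generate all permutations, and a swap is the symmetry of the second derivative.
-/
theorem iterLineDeriv_perm {U : Set E} (hU : IsOpen U) {f : E → F}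
    (hf : ContDiffOn ℝ ∞ f U) {l l' : List E} (h : l.Perm l') {x : E} (hx : x ∈ U) :
    iterLineDeriv f l x = iterLineDeriv f l' x := by
  induction h generalizing x with
  | nil => rfl
  | @cons v l₁ l₂ _ ih =>
    have : iterLineDeriv f l₁ =ᶠ[𝓝 x] iterLineDeriv f l₂ := by
      filter_upwards [hU.mem_nhds hx] with y hy using ih hy
    exact congrArg (fun T : E →L[ℝ] F => T v) this.fderiv_eq
  | swap v w l =>
    have hg := (contDiffOn_iterLineDeriv hU hf l).contDiffAt (hU.mem_nhds hx)
    have hd : DifferentiableAt ℝ (fderiv ℝ (iterLineDeriv f l)) x :=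
      (hg.fderiv_right (m := 1) (by norm_cast)).differentiableAt (by simp)
    have key : ∀ a b : E, iterLineDeriv f (a :: b :: l) x
        = fderiv ℝ (fderiv ℝ (iterLineDeriv f l)) x a b := fun a b => by
      have := hd.hasFDerivAt.clm_apply (hasFDerivAt_const b x)
      exact (congrArg (fun T : E →L[ℝ] F => T a) this.fderiv).trans (by simp)
    rw [key, key]
    exact hg.isSymmSndFDerivAt (by rw [minSmoothness_of_isRCLikeNormedField]; norm_cast) w v
  | trans _ _ ih₁ ih₂ => rw [ih₁ hx, ih₂ hx]

end General

/-! ### Full derivatives controlled by the seminorms -/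

theorem ofFn_comp_equiv_perm {α : Type*} {m n : ℕ} (e : Fin m ≃ Fin n) (f : Fin n → α) :
    (List.ofFn (f ∘ e)).Perm (List.ofFn f) := by
  obtain rfl : m = n := Fin.equiv_iff_eq.1 ⟨e⟩
  exact Equiv.Perm.ofFn_comp_perm e f

/-- The multi-index counting how often each coordinate occurs in the family `g`. -/
def countIndex {d n : ℕ} (g : Fin n → Fin d) : Fin d → ℕ := fun i => Fintype.card {j // g j = i}

theorem partialDeriv_countIndex {d n : ℕ} {U : Set (Euc d)} (hU : IsOpen U) {f : Euc d → ℂ}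
    (hf : ContDiffOn ℝ ∞ f U) (g : Fin n → Fin d) {x : Euc d} (hx : x ∈ U) :
    partialDeriv (countIndex g) f x
      = iteratedFDeriv ℝ n f x fun j => EuclideanSpace.single (g j) (1 : ℝ) := by
  -- Grouping the positions by the fibres of g turns the sorted list of coordinate vectors in
  -- `partialDeriv` into a permutation of the list given by g.
  let e : Fin (∑ i, countIndex g i) ≃ Fin n := finSigmaFinEquiv.symm.trans
    ((Equiv.sigmaCongrRight fun i => (Fintype.equivFin {j // g j = i}).symm).trans
      (Equiv.sigmaFiberEquiv g))
  have he : ∀ j, g (e j) = (finSigmaFinEquiv.symm j).1 := fun j =>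
    ((Fintype.equivFin {l // g l = (finSigmaFinEquiv.symm j).1}).symm
      (finSigmaFinEquiv.symm j).2).2
  rw [partialDeriv, iteratedFDeriv_eq_iterLineDeriv hU hf _ hx,
    iteratedFDeriv_eq_iterLineDeriv hU hf _ hx]
  simp_rw [← he]
  exact iterLineDeriv_perm hU hf
    (ofFn_comp_equiv_perm e fun j => EuclideanSpace.single (g j) (1 : ℝ)) hx

theorem norm_multilinear_le_sum {d n : ℕ} {F : Type*} [NormedAddCommGroup F] [NormedSpace ℝ F]
    (M : ContinuousMultilinearMap ℝ (fun _ : Fin n => Euc d) F) :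
    ‖M‖ ≤ ∑ g : Fin n → Fin d, ‖M fun j => EuclideanSpace.single (g j) (1 : ℝ)‖ := by
  refine ContinuousMultilinearMap.opNorm_le_bound (by positivity) fun v => ?_
  have hv : v = fun i => ∑ j, v i j • EuclideanSpace.single j (1 : ℝ) := by
    funext i
    ext l
    simp [Finset.sum_apply, Pi.single_apply]
  conv_lhs => rw [hv]
  have h := M.toMultilinearMap.map_sum fun i j => v i j • EuclideanSpace.single j (1 : ℝ)
  simp only [ContinuousMultilinearMap.coe_coe] at h
  rw [h, Finset.sum_mul]
  refine norm_sum_le_of_le _ fun g _ => ?_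
  have h2 := M.toMultilinearMap.map_smul_univ (fun i => v i (g i))
    fun i => EuclideanSpace.single (g i) (1 : ℝ)
  simp only [ContinuousMultilinearMap.coe_coe] at h2
  rw [h2, norm_smul, norm_prod, mul_comm]
  gcongr with i
  exact PiLp.norm_apply_le (v i) (g i)

theorem norm_le_sum_of_mem_orthant {d : ℕ} {x : Euc d} (hx : x ∈ orthant d) : ‖x‖ ≤ ∑ i, x i := by
  have h : x = ∑ j, x j • EuclideanSpace.single j (1 : ℝ) := by
    ext l
    simp [Finset.sum_apply, Pi.single_apply]
  conv_lhs => rw [h]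
  refine norm_sum_le_of_le _ fun i _ => ?_
  rw [norm_smul, PiLp.norm_single, norm_one, mul_one, Real.norm_of_nonneg (hx i).le]

theorem le_seminorm {d : ℕ} (k p : Fin d → ℕ) (f : Space d) {x : Euc d} (hx : x ∈ orthant d) :
    monomial k x * ‖partialDeriv p (extendZero f.toFun) x‖ ≤ seminorm k p f :=
  le_ciSup (f.bddAbove k p) ⟨x, hx⟩

/-- On the orthant ‖x‖ ≤ ∑ x_i, so the multinomial theorem bounds ‖x‖^k by monomials. The operator
norm is bounded by the values on coordinate vectors, which are partial derivatives. -/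
theorem exists_norm_iteratedFDeriv_le (d k n : ℕ) :
    ∃ (S : Finset ((Fin d → ℕ) × (Fin d → ℕ))) (C : NNReal), ∀ (f : Space d), ∀ x ∈ orthant d,
      ‖x‖ ^ k * ‖iteratedFDeriv ℝ n (extendZero f.toFun) x‖
        ≤ C * (S.sup (seminormFamily d)) f := by
  let K := (Finset.univ : Finset (Fin d)).piAntidiag k
  refine ⟨K ×ˢ Finset.univ.image fun g : Fin n → Fin d => countIndex g,
    ∑ κ ∈ K, ∑ _g : Fin n → Fin d, (Nat.multinomial Finset.univ κ : NNReal), fun f x hx => ?_⟩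
  have h1 : ‖x‖ ^ k ≤ ∑ κ ∈ K, (Nat.multinomial Finset.univ κ : ℝ) * monomial κ x := by
    refine (pow_le_pow_left₀ (norm_nonneg _) (norm_le_sum_of_mem_orthant hx) k).trans_eq ?_
    exact Finset.sum_pow_eq_sum_piAntidiag _ _ _
  have h2 := norm_multilinear_le_sum (iteratedFDeriv ℝ n (extendZero f.toFun) x)
  have h0 : ∀ κ ∈ K, 0 ≤ (Nat.multinomial Finset.univ κ : ℝ) * monomial κ x := fun κ _ =>
    mul_nonneg (Nat.cast_nonneg _) (monomial_nonneg κ hx)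
  refine (mul_le_mul h1 h2 (norm_nonneg _) (Finset.sum_nonneg h0)).trans ?_
  rw [Finset.sum_mul_sum]
  push_cast
  rw [Finset.sum_mul]
  refine Finset.sum_le_sum fun κ hκ => ?_
  rw [Finset.sum_mul]
  refine Finset.sum_le_sum fun g _ => ?_
  rw [mul_assoc, ← partialDeriv_countIndex (isOpen_orthant d) f.isSchwartz.smooth g hx]
  gcongr
  refine (le_seminorm κ _ f hx).trans ?_
  exact Seminorm.le_finset_sup_apply (p := seminormFamily d) (i := (κ, countIndex g))
    (Finset.mem_product.2 ⟨hκ,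
      Finset.mem_image_of_mem (fun g => countIndex g) (Finset.mem_univ g)⟩)

/-! ### The extension operator -/

theorem closure_orthant (d : ℕ) : closure (orthant d) = nonnegCone Finset.univ := by
  refine Set.Subset.antisymm (closure_minimal (fun x hx i _ => (hx i).le)
    (isClosed_nonnegCone _)) fun x hx => ?_
  have h : Filter.Tendsto (fun t : ℝ => x + t • (WithLp.toLp 2 fun _ => (1 : ℝ) : Euc d))
      (𝓝[>] 0) (𝓝 x) := by
    have : Continuous fun t : ℝ => x + t • (WithLp.toLp 2 fun _ => (1 : ℝ) : Euc d) := by fun_prop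
    simpa using (this.tendsto 0).mono_left nhdsWithin_le_nhds
  refine mem_closure_of_tendsto h ?_
  filter_upwards [self_mem_nhdsWithin] with t ht i
  simpa using add_pos_of_nonneg_of_pos (hx i (Finset.mem_univ i)) (show (0 : ℝ) < t from ht)

theorem convex_orthant (d : ℕ) : Convex ℝ (orthant d) := by
  intro x hx y hy a b ha hb hab i
  simpa using convex_Ioi (0 : ℝ) (hx i) (hy i) ha hb hab

/-- The map s is only a choice of extensions: neither linearity nor continuity away from 0 is
claimed. The right-inverse property and the seminorm bounds suffice for openness and duality. -/
theorem exists_extension (d : ℕ) :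
    ∃ s : Space d → 𝓢(Euc d, ℂ), (∀ f, restrict d (s f) = f) ∧
      ∀ i : ℕ × ℕ, ∃ (S : Finset ((Fin d → ℕ) × (Fin d → ℕ))) (C : NNReal), ∀ f,
        schwartzSeminormFamily ℂ (Euc d) ℂ i (s f) ≤ C * (S.sup (seminormFamily d)) f := by
  obtain ⟨C, hC⟩ := exists_jet_extension (d := d) ℂ Finset.univ
  choose S D hSD using exists_norm_iteratedFDeriv_le d
  have main : ∀ f : Space d, ∃ F : 𝓢(Euc d, ℂ), restrict d F = f ∧ ∀ k n x,
      ‖x‖ ^ k * ‖iteratedFDeriv ℝ n F x‖ ≤ C n * (D k n * ((S k n).sup (seminormFamily d)) f) := by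
    intro f
    obtain ⟨p, hp, hpf⟩ := exists_jet_closure (isOpen_orthant d) (convex_orthant d)
      f.isSchwartz.smooth fun n => ⟨_, fun x hx => by simpa using hSD 0 n f x hx⟩
    -- The weighted bounds pass from the open orthant to its closure by continuity.
    have hbd : ∀ k n, ∀ x ∈ nonnegCone (Finset.univ : Finset (Fin d)),
        ‖x‖ ^ k * ‖p x n‖ ≤ D k n * ((S k n).sup (seminormFamily d)) f := by
      intro k n x hx
      rw [← closure_orthant] at hx
      have hcont : ContinuousOn (fun x => ‖x‖ ^ k * ‖p x n‖) (closure (orthant d)) :=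
        (continuous_norm.pow k).continuousOn.mul
          (hp.cont n (by exact_mod_cast le_top)).norm
      exact ContinuousWithinAt.closure_le hx ((hcont x hx).mono subset_closure)
        continuousWithinAt_const (fun y hy => by rw [hpf y hy]; exact hSD k n f y hy)
    obtain ⟨q, hq, hqp, hqb⟩ := hC p (closure_orthant d ▸ hp)
      fun n => ⟨_, fun x hx => by simpa using hbd 0 n x hx⟩
    have hq' := hasFTaylorSeriesUpToOn_univ_iff.1 hq
    have hqi : ∀ n x, iteratedFDeriv ℝ n (fun x => (q x 0).curry0) x = q x n := fun n x =>
      (hq'.eq_iteratedFDeriv (by exact_mod_cast le_top) x).symm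
    refine ⟨⟨fun x => (q x 0).curry0, hq'.contDiff,
      fun k n => ⟨C n * (D k n * ((S k n).sup (seminormFamily d)) f), fun x => ?_⟩⟩, ?_, ?_⟩
    · rw [hqi]
      exact hqb k n _ (hbd k n) x
    · refine Subtype.ext (funext fun x => ?_)
      change (q x 0).curry0 = f.toFun x
      rw [hqp x fun i _ => (x.2 i).le, hpf x x.2]
      simp [extendZero_apply]
    · intro k n x
      change ‖x‖ ^ k * ‖iteratedFDeriv ℝ n (fun x => (q x 0).curry0) x‖ ≤ _
      rw [hqi]
      exact hqb k n _ (hbd k n) x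
  choose s hs hsb using main
  refine ⟨s, hs, fun i => ⟨S i.1 i.2, (C i.2).toNNReal * D i.1 i.2, fun f => ?_⟩⟩
  refine SchwartzMap.seminorm_le_bound ℂ i.1 i.2 (s f) (by positivity) fun x => ?_
  refine (hsb f i.1 i.2 x).trans ?_
  push_cast
  rw [mul_assoc]
  gcongr
  exact Real.le_coe_toNNReal _

/-! ### Tempered distributions vanish on functions supported off their support -/

section Support

variable {E : Type*} [NormedAddCommGroup E] [NormedSpace ℝ E]

theorem tendsto_of_seminorm_le {f : 𝓢(E, ℂ)} {u : ℝ → 𝓢(E, ℂ)}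
    (h : ∀ k n, ∃ C, ∀ t ∈ Set.Ioc (0 : ℝ) 1, SchwartzMap.seminorm ℂ k n (u t - f) ≤ C * t) :
    Filter.Tendsto u (𝓝[>] 0) (𝓝 f) := by
  rw [(schwartz_withSeminorms ℂ E ℂ).tendsto_nhds]
  intro i ε hε
  obtain ⟨C, hC⟩ := h i.1 i.2
  have h0 : Filter.Tendsto (fun t : ℝ => C * t) (𝓝[>] 0) (𝓝 0) := by
    have : Continuous fun t : ℝ => C * t := by fun_prop
    simpa using (this.tendsto 0).mono_left nhdsWithin_le_nhds
  filter_upwards [h0.eventually_lt_const hε, Ioc_mem_nhdsGT (zero_lt_one' ℝ)] with t ht ht1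
  exact (hC t ht1).trans_lt ht

theorem tendsto_compSubConstCLM (f : 𝓢(E, ℂ)) (v : E) :
    Filter.Tendsto (fun t : ℝ => SchwartzMap.compSubConstCLM ℂ (-(t • v)) f) (𝓝[>] 0) (𝓝 f) := by
  refine tendsto_of_seminorm_le fun k n => ?_
  set A := SchwartzMap.seminorm ℂ k (n + 1) f with hA
  set B := SchwartzMap.seminorm ℂ 0 (n + 1) f with hB
  have hA0 : 0 ≤ A := apply_nonneg _ _
  have hB0 : 0 ≤ B := apply_nonneg _ _
  -- This comes from the mean value inequality on the segment from x to x + tv, with ‖x‖ ≤ ‖z‖ + ‖v‖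
  -- for z on it and (a + b)^k ≤ 2^(k-1) (a^k + b^k).
  refine ⟨2 ^ (k - 1) * (A + ‖v‖ ^ k * B) * ‖v‖, fun t ht => ?_⟩
  have ht0 : 0 < t := ht.1
  refine SchwartzMap.seminorm_le_bound ℂ k n _ (by positivity) fun x => ?_
  have hfn : ContDiff ℝ n f := f.smooth n
  have e : iteratedFDeriv ℝ n (SchwartzMap.compSubConstCLM ℂ (-(t • v)) f - f : 𝓢(E, ℂ)) x
      = iteratedFDeriv ℝ n f (x + t • v) - iteratedFDeriv ℝ n f x := by
    have h1 : ((SchwartzMap.compSubConstCLM ℂ (-(t • v)) f - f : 𝓢(E, ℂ)) : E → ℂ)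
        = (fun y => f (y + t • v)) - f := by
      funext y; simp
    have h2 : ContDiff ℝ n fun y => f (y + t • v) := hfn.comp (contDiff_id.add contDiff_const)
    rw [h1, iteratedFDeriv_sub_apply h2.contDiffAt hfn.contDiffAt, iteratedFDeriv_comp_add_right]
  rw [e, ← norm_norm x, ← norm_pow, ← norm_smul, smul_sub]
  have hd : ∀ z, HasFDerivAt (fun z => ‖x‖ ^ k • iteratedFDeriv ℝ n f z)
      (‖x‖ ^ k • fderiv ℝ (iteratedFDeriv ℝ n f) z) z := fun z =>
    (((f.smooth (n + 1)).contDiffAt.differentiableAt_iteratedFDeriv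
      (by norm_cast; simp)).hasFDerivAt).fun_const_smul _
  have hmv := Convex.norm_image_sub_le_of_norm_hasFDerivWithin_le (𝕜 := ℝ)
    (C := 2 ^ (k - 1) * (A + ‖v‖ ^ k * B))
    (fun z _ => (hd z).hasFDerivWithinAt) (fun z hz => ?_) (convex_segment x (x + t • v))
    (left_mem_segment ℝ _ _) (right_mem_segment ℝ _ _)
  · refine hmv.trans_eq ?_
    rw [add_sub_cancel_left, norm_smul, Real.norm_of_nonneg ht0.le]
    ring
  · have hxz : ‖x‖ ≤ ‖z‖ + ‖v‖ := by
      rw [segment_eq_image'] at hz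
      obtain ⟨θ, hθ, rfl⟩ := hz
      have : ‖θ • (t • v)‖ ≤ ‖v‖ := by
        rw [smul_smul, norm_smul, Real.norm_of_nonneg (mul_nonneg hθ.1 ht0.le)]
        exact mul_le_of_le_one_left (norm_nonneg _) (mul_le_one₀ hθ.2 ht0.le ht.2)
      simp only [add_sub_cancel_left]
      calc ‖x‖ = ‖x + θ • (t • v) - θ • (t • v)‖ := by rw [add_sub_cancel_right]
        _ ≤ _ := (norm_sub_le _ _).trans (by gcongr)
    rw [norm_smul, norm_fderiv_iteratedFDeriv, norm_pow, norm_norm]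
    calc ‖x‖ ^ k * ‖iteratedFDeriv ℝ (n + 1) f z‖
        ≤ 2 ^ (k - 1) * (‖z‖ ^ k + ‖v‖ ^ k) * ‖iteratedFDeriv ℝ (n + 1) f z‖ := by
          gcongr
          exact (pow_le_pow_left₀ (norm_nonneg _) hxz k).trans
            (add_pow_le (norm_nonneg _) (norm_nonneg _) k)
      _ = 2 ^ (k - 1) * (‖z‖ ^ k * ‖iteratedFDeriv ℝ (n + 1) f z‖
            + ‖v‖ ^ k * ‖iteratedFDeriv ℝ (n + 1) f z‖) := by ring
      _ ≤ _ := by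
          gcongr
          · exact SchwartzMap.le_seminorm ℂ k (n + 1) f z
          · exact SchwartzMap.norm_iteratedFDeriv_le_seminorm ℂ f (n + 1) z

/-- The function ψ = χ - 1 vanishes on the unit ball, so each of its derivatives at y is O(‖y‖). At
y = tx this yields a factor t at the price of one more power of ‖x‖, absorbed by the decay of f. -/
theorem tendsto_smulLeftCLM_comp_smul {χ : 𝓢(E, ℂ)} (hχ : ∀ x ∈ Metric.ball (0 : E) 1, χ x = 1)
    (hg : ∀ t : ℝ, Function.HasTemperateGrowth fun x => χ (t • x)) (f : 𝓢(E, ℂ)) :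
    Filter.Tendsto (fun t : ℝ => SchwartzMap.smulLeftCLM ℂ (fun x => χ (t • x)) f)
      (𝓝[>] 0) (𝓝 f) := by
  let ψ : E → ℂ := fun x => χ x - 1
  have hψ : ContDiff ℝ ∞ ψ := (χ.smooth ⊤).sub contDiff_const
  have hψb : ∀ i, ∃ C, 0 ≤ C ∧ ∀ y, ‖iteratedFDeriv ℝ i ψ y‖ ≤ C * ‖y‖ := by
    intro i
    refine ⟨SchwartzMap.seminorm ℂ 0 i χ + 1, add_nonneg (apply_nonneg _ _) zero_le_one,
      fun y => ?_⟩
    by_cases hy : y ∈ Metric.ball (0 : E) 1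
    · have : ψ =ᶠ[𝓝 y] fun _ => 0 := by
        filter_upwards [Metric.isOpen_ball.mem_nhds hy] with z hz
        simp [ψ, hχ z hz]
      rw [(this.iteratedFDeriv ℝ i).eq_of_nhds]
      simp only [iteratedFDeriv_fun_zero, Pi.zero_apply, norm_zero]
      exact mul_nonneg (add_nonneg (apply_nonneg _ _) zero_le_one) (norm_nonneg _)
    · have hy1 : 1 ≤ ‖y‖ := by simpa using hy
      refine le_trans ?_ (le_mul_of_one_le_right
        (add_nonneg (apply_nonneg _ _) zero_le_one) hy1)
      have e : iteratedFDeriv ℝ i ψ y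
          = iteratedFDeriv ℝ i χ y - iteratedFDeriv ℝ i (fun _ : E => (1 : ℂ)) y :=
        iteratedFDeriv_sub_apply (χ.smooth i).contDiffAt contDiff_const.contDiffAt
      rw [e]
      refine (norm_sub_le _ _).trans (add_le_add
        (SchwartzMap.norm_iteratedFDeriv_le_seminorm ℂ χ i y) ?_)
      rcases Nat.eq_zero_or_pos i with rfl | hi
      · simp
      · rw [iteratedFDeriv_const_of_ne hi.ne']
        simp
  choose c hc0 hc using hψb
  refine tendsto_of_seminorm_le fun k n => ⟨∑ i ∈ Finset.range (n + 1),
    (n.choose i : ℝ) * c i * SchwartzMap.seminorm ℂ (k + 1) (n - i) f, fun t ht => ?_⟩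
  have ht0 : 0 ≤ t := ht.1.le
  refine SchwartzMap.seminorm_le_bound ℂ k n _ (mul_nonneg (Finset.sum_nonneg fun i _ =>
    mul_nonneg (mul_nonneg (Nat.cast_nonneg _) (hc0 i)) (apply_nonneg _ _)) ht0) fun x => ?_
  have e : ((SchwartzMap.smulLeftCLM ℂ (fun x => χ (t • x)) f - f : 𝓢(E, ℂ)) : E → ℂ)
      = fun y => (ψ ∘ (t • ContinuousLinearMap.id ℝ E)) y • f y := by
    funext y
    simp [ψ, SchwartzMap.smulLeftCLM_apply_apply (hg t), sub_mul]
  rw [e]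
  have hL : ‖t • ContinuousLinearMap.id ℝ E‖ ≤ 1 := by
    rw [norm_smul, Real.norm_of_nonneg ht0]
    exact mul_le_one₀ ht.2 (norm_nonneg _) ContinuousLinearMap.norm_id_le
  have hb : ∀ i, ‖iteratedFDeriv ℝ i (ψ ∘ (t • ContinuousLinearMap.id ℝ E)) x‖
      ≤ c i * (t * ‖x‖) := by
    intro i
    rw [ContinuousLinearMap.iteratedFDeriv_comp_right _ hψ x (by exact_mod_cast le_top)]
    refine (ContinuousMultilinearMap.norm_compContinuousLinearMap_le _ _).trans ?_
    rw [Finset.prod_const]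
    refine (mul_le_of_le_one_right (norm_nonneg _) (pow_le_one₀ (norm_nonneg _) hL)).trans ?_
    refine (hc i _).trans_eq ?_
    simp [norm_smul, abs_of_nonneg ht0]
  have hl := norm_iteratedFDeriv_smul_le (N := ∞)
    (hψ.comp (t • ContinuousLinearMap.id ℝ E).contDiff) (f.smooth ⊤) x
    (n := n) (by exact_mod_cast le_top)
  refine (mul_le_mul_of_nonneg_left hl (by positivity)).trans ?_
  rw [Finset.mul_sum, Finset.sum_mul]
  refine Finset.sum_le_sum fun i _ => ?_
  calc ‖x‖ ^ k * ((n.choose i : ℝ) * ‖iteratedFDeriv ℝ i (ψ ∘ (t • ContinuousLinearMap.id ℝ E)) x‖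
        * ‖iteratedFDeriv ℝ (n - i) f x‖)
      ≤ ‖x‖ ^ k * ((n.choose i : ℝ) * (c i * (t * ‖x‖)) * ‖iteratedFDeriv ℝ (n - i) f x‖) := by
        gcongr
        exact hb i
    _ = (n.choose i : ℝ) * c i * (‖x‖ ^ (k + 1) * ‖iteratedFDeriv ℝ (n - i) f x‖) * t := by ring
    _ ≤ _ := by
        have := hc0 i
        gcongr
        exact SchwartzMap.le_seminorm ℂ (k + 1) (n - i) f x

variable [FiniteDimensional ℝ E]

open scoped Manifold in
theorem exists_contDiff_partition {ι : Type*} [Fintype ι] {K : Set E} (hK : IsClosed K)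
    {U : ι → Set E} (hU : ∀ i, IsOpen (U i)) (h : K ⊆ ⋃ i, U i) :
    ∃ ρ : ι → E → ℝ, (∀ i, ContDiff ℝ ∞ (ρ i)) ∧ (∀ i, tsupport (ρ i) ⊆ U i) ∧
      ∀ x ∈ K, ∑ i, ρ i x = 1 := by
  obtain ⟨ρ, hρ⟩ := SmoothPartitionOfUnity.exists_isSubordinate 𝓘(ℝ, E) hK U hU h
  exact ⟨fun i => ρ i, fun i => (ρ i).contMDiff.contDiff, hρ, fun x hx => by
    rw [← finsum_eq_sum_of_fintype, ρ.sum_eq_one hx]⟩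

/-- Finitely many open sets on which T vanishes cover the support of f, and a smooth partition of
unity splits f into pieces supported in them. -/
theorem apply_eq_zero_of_hasCompactSupport (T : StrongDual ℂ 𝓢(E, ℂ)) (f : 𝓢(E, ℂ))
    (hf : HasCompactSupport f) (h : ∀ x ∈ tsupport f, x ∉ Distribution.dsupport T) :
    T f = 0 := by
  have hloc : ∀ x : tsupport f, ∃ s, Distribution.IsVanishingOn T s ∧ IsOpen s ∧ (x : E) ∈ s :=
    fun x => (Distribution.notMem_dsupport_iff (x : E)).1 (h x x.2)
  choose U hU hUo hxU using hloc
  obtain ⟨I, hI⟩ := hf.isCompact.elim_finite_subcover U hUo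
    fun x hx => Set.mem_iUnion.2 ⟨⟨x, hx⟩, hxU ⟨x, hx⟩⟩
  obtain ⟨ρ, hρc, hρU, hρ1⟩ := exists_contDiff_partition (isClosed_tsupport f)
    (fun i : I => hUo i) (by simpa [Set.iUnion_subtype] using hI)
  have hex : ∀ i : I, ∃ g : 𝓢(E, ℂ), (g : E → ℂ) = fun x => ρ i x • f x := fun i => by
    have h2 : HasCompactSupport fun x => ρ i x • f x :=
      hf.mono (Function.support_smul_subset_right (ρ i) f)
    exact ⟨h2.toSchwartzMap ((hρc i).smul (f.smooth ⊤)), rfl⟩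
  choose g hg using hex
  have hsum : f = ∑ i, g i := by
    ext x
    rw [sum_apply]
    simp_rw [hg]
    rw [← Finset.sum_smul]
    by_cases hxs : x ∈ tsupport f
    · rw [hρ1 x hxs, one_smul]
    · rw [image_eq_zero_of_notMem_tsupport hxs, smul_zero]
  rw [hsum, map_sum]
  refine Finset.sum_eq_zero fun i _ => hU i (g i) ?_
  rw [hg]
  exact (tsupport_smul_subset_left (ρ i) f).trans (hρU i)

/-- The cut-offs χ(tx) f(x) have compact support inside that of f and converge to f as t → 0, which
reduces the claim to compact support. -/
theorem apply_eq_zero_of_disjoint_dsupport (T : StrongDual ℂ 𝓢(E, ℂ)) (f : 𝓢(E, ℂ))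
    (h : ∀ x ∈ tsupport f, x ∉ Distribution.dsupport T) : T f = 0 := by
  let b : ContDiffBump (0 : E) := ⟨1, 2, one_pos, one_lt_two⟩
  have hb : HasCompactSupport fun x => (b x : ℂ) :=
    b.hasCompactSupport.comp_left (g := fun r : ℝ => (r : ℂ)) Complex.ofReal_zero
  obtain ⟨χ, hχb⟩ : ∃ χ : 𝓢(E, ℂ), (χ : E → ℂ) = fun x => (b x : ℂ) :=
    ⟨hb.toSchwartzMap (Complex.ofRealCLM.contDiff.comp b.contDiff), rfl⟩
  have hχ : ∀ x ∈ Metric.ball (0 : E) 1, χ x = 1 := fun x hx => by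
    simp only [hχb]
    rw [b.one_of_mem_closedBall (Metric.ball_subset_closedBall hx), Complex.ofReal_one]
  have hg : ∀ t : ℝ, Function.HasTemperateGrowth fun x => χ (t • x) := fun t =>
    χ.hasTemperateGrowth.comp (t • ContinuousLinearMap.id ℝ E).hasTemperateGrowth
  have hlim := (T.continuous.tendsto f).comp (tendsto_smulLeftCLM_comp_smul hχ hg f)
  refine tendsto_nhds_unique hlim (tendsto_const_nhds.congr' ?_)
  filter_upwards [self_mem_nhdsWithin] with t ht
  have ht0 : t ≠ 0 := (show (0 : ℝ) < t from ht).ne'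
  have hcoe := SchwartzMap.smulLeftCLM_apply (hg t) f
  refine (apply_eq_zero_of_hasCompactSupport T
    (SchwartzMap.smulLeftCLM ℂ (fun x => χ (t • x)) f) ?_ fun x hx => h x ?_).symm
  · rw [hcoe]
    rw [← hχb] at hb
    exact (hb.comp_smul ht0).mono (Function.support_smul_subset_left (fun x => χ (t • x)) f)
  · rw [hcoe] at hx
    exact tsupport_smul_subset_right _ _ hx

end Support

/-! ### The restriction map, its quotient and its transpose -/

theorem continuous_restrict (d : ℕ) : Continuous (restrict d) := by
  refine WithSeminorms.continuous_of_isBounded (schwartz_withSeminorms ℂ (Euc d) ℂ) (withSeminorms d) _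
    fun i => ⟨{(∑ j, i.1 j, ∑ j, i.2 j)}, 1, fun f => ?_⟩
  rw [one_smul, Finset.sup_singleton]
  exact ciSup_le fun x => restrict_bound f i.1 i.2 x.2

theorem isOpenQuotientMap_restrict (d : ℕ) : IsOpenQuotientMap (restrict d) := by
  obtain ⟨s, hs, hsb⟩ := exists_extension d
  refine ⟨fun f => ⟨s f, hs f⟩, continuous_restrict d, ?_⟩
  rw [IsTopologicalAddGroup.isOpenMap_iff_nhds_zero]
  have hlim : Filter.Tendsto s (𝓝 0) (𝓝 0) := by
    rw [(schwartz_withSeminorms ℂ (Euc d) ℂ).tendsto_nhds]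
    intro i ε hε
    obtain ⟨S, C, hC⟩ := hsb i
    have hq : Continuous fun f : Space d => (C : ℝ) * (S.sup (seminormFamily d)) f :=
      continuous_const.mul ((S.sup (seminormFamily d)).continuous_of_continuousAt_zero
        (Seminorm.continuousAt_zero ((withSeminorms d).hasBasis_zero_ball.mem_of_mem
          (i := (S, 1)) one_pos)))
    have h0 := hq.tendsto 0
    rw [map_zero, mul_zero] at h0
    filter_upwards [h0.eventually_lt_const hε] with f hf
    rw [sub_zero]
    exact (hC f).trans_lt hf
  -- As R ∘ s = id and s tends to 0 at 0, the image under R of any neighbourhood of 0 is a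
  -- neighbourhood of 0.
  calc 𝓝 (0 : Space d) = Filter.map (restrict d) (Filter.map s (𝓝 0)) := by
        rw [Filter.map_map, show restrict d ∘ s = id from funext hs, Filter.map_id]
    _ ≤ _ := Filter.map_mono hlim

theorem mem_nullSpace_iff {d : ℕ} (f : 𝓢(Euc d, ℂ)) : f ∈ nullSpace d ↔ ∀ x ∈ orthant d, f x = 0 := by
  refine ⟨fun hf x hx => image_eq_zero_of_notMem_tsupport fun h => hf h hx, fun hf => ?_⟩
  exact closure_minimal (fun x hx h => hx (hf x h)) (isOpen_orthant d).isClosed_compl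

theorem ker_restrict (d : ℕ) : LinearMap.ker (restrict d) = nullSpace d := by
  ext f
  rw [mem_nullSpace_iff, LinearMap.mem_ker]
  exact ⟨fun h x hx => congrFun (congrArg Space.toFun h) ⟨x, hx⟩,
    fun h => Subtype.ext (funext fun x => h x x.2)⟩

theorem exists_quotient_equiv (d : ℕ) :
    ∃ Φ : (𝓢(Euc d, ℂ) ⧸ nullSpace d) ≃L[ℂ] Space d,
      ∀ f : 𝓢(Euc d, ℂ), Φ (Submodule.Quotient.mk f) = restrict d f := by
  have hR := isOpenQuotientMap_restrict d
  let e : (𝓢(Euc d, ℂ) ⧸ nullSpace d) ≃ₗ[ℂ] Space d :=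
    (Submodule.quotEquivOfEq _ _ (ker_restrict d).symm).trans
      ((restrict d).quotKerEquivOfSurjective hR.surjective)
  have he : ∀ f, e ((nullSpace d).mkQ f) = restrict d f := fun f => rfl
  refine ⟨⟨e, ?_, ?_⟩, he⟩
  · refine (nullSpace d).isOpenQuotientMap_mkQ.isQuotientMap.continuous_iff.2 ?_
    exact hR.continuous.congr he
  · refine hR.isQuotientMap.continuous_iff.2 ?_
    refine (nullSpace d).isOpenQuotientMap_mkQ.continuous.congr fun f => ?_
    exact (e.symm_apply_eq.2 (he f).symm).symm

/-- The support of f ∈ N may meet that of T on the boundary of the orthant. The shift f(· + tv) with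
v = (1, …, 1) and t > 0 vanishes near the closed orthant, so T annihilates it, and t → 0 gives T f =
0. Conversely, functions supported off the closed orthant belong to N. -/
theorem mem_supportedDistributions_iff {d : ℕ} (T : StrongDual ℂ 𝓢(Euc d, ℂ)) :
    T ∈ supportedDistributions d ↔ ∀ f ∈ nullSpace d, T f = 0 := by
  constructor
  · intro hT f hf
    rw [mem_nullSpace_iff] at hf
    let v : Euc d := WithLp.toLp 2 fun _ => 1
    refine tendsto_nhds_unique ((T.continuous.tendsto f).comp (tendsto_compSubConstCLM f v))
      (tendsto_const_nhds.congr' ?_)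
    filter_upwards [self_mem_nhdsWithin] with t ht
    refine (apply_eq_zero_of_disjoint_dsupport T _ fun x hx hxT => ?_).symm
    have hx0 := hT hxT
    rw [closure_orthant] at hx0
    have hxo : x + t • v ∈ orthant d := fun i => by
      simpa [v] using add_pos_of_nonneg_of_pos (hx0 i (Finset.mem_univ i)) (show (0 : ℝ) < t from ht)
    refine notMem_tsupport_iff_eventuallyEq.2 ?_ hx
    have hc : Continuous fun y : Euc d => y + t • v := by fun_prop
    filter_upwards [hc.continuousAt.preimage_mem_nhds ((isOpen_orthant d).mem_nhds hxo)] with y hy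
    rw [SchwartzMap.compSubConstCLM_apply, sub_neg_eq_add]
    exact hf _ hy
  · intro h x hx
    by_contra hxc
    refine (Distribution.notMem_dsupport_iff x).2 ⟨(closure (orthant d))ᶜ, fun u hu => h u ?_,
      isClosed_closure.isOpen_compl, hxc⟩ hx
    exact hu.trans (Set.compl_subset_compl.2 subset_closure)

theorem isClosed_supportedDistributions (d : ℕ) :
    IsClosed (supportedDistributions d : Set (StrongDual ℂ 𝓢(Euc d, ℂ))) := by
  have h : (supportedDistributions d : Set (StrongDual ℂ 𝓢(Euc d, ℂ)))
      = ⋂ f ∈ nullSpace d, {T | T f = 0} := by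
    ext T
    simp only [SetLike.mem_coe, mem_supportedDistributions_iff, Set.mem_iInter]
    rfl
  rw [h]
  exact isClosed_biInter fun f _ => isClosed_eq (continuous_eval_const f) continuous_const

theorem exists_dual_equiv (d : ℕ) :
    ∃ Ψ : StrongDual ℂ (Space d) ≃L[ℂ] supportedDistributions d,
      ∀ (T : StrongDual ℂ (Space d)) (f : 𝓢(Euc d, ℂ)),
        (Ψ T : StrongDual ℂ 𝓢(Euc d, ℂ)) f = T (restrict d f) := by
  have hR := isOpenQuotientMap_restrict d
  obtain ⟨s, hs, hsb⟩ := exists_extension d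
  let R : 𝓢(Euc d, ℂ) →L[ℂ] Space d := ⟨restrict d, hR.continuous⟩
  let P : StrongDual ℂ (Space d) →L[ℂ] supportedDistributions d :=
    (ContinuousLinearMap.precomp ℂ R).codRestrict (supportedDistributions d) fun T => by
      rw [mem_supportedDistributions_iff]
      intro f hf
      rw [← ker_restrict] at hf
      exact (congrArg T hf).trans T.map_zero
  have hP : ∀ T f, (P T : StrongDual ℂ 𝓢(Euc d, ℂ)) f = T (restrict d f) := fun _ _ => rfl
  have hinj : Function.Injective P := fun T T' h => by
    ext f
    rw [← hs f, ← hP, ← hP, h]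
  have hsurj : Function.Surjective P := by
    rintro ⟨S, hS⟩
    rw [mem_supportedDistributions_iff] at hS
    -- S depends only on the restriction, so S ∘ s is linear whether or not s is.
    have key : ∀ f g, restrict d f = restrict d g → S f = S g := fun f g h => by
      rw [← sub_eq_zero, ← map_sub]
      refine hS _ ?_
      rw [← ker_restrict, LinearMap.mem_ker, map_sub, h, sub_self]
    let T : StrongDual ℂ (Space d) :=
      { toFun := fun f => S (s f)
        map_add' := fun f g => by
          rw [← map_add]
          exact key _ _ (by rw [map_add, hs, hs, hs])
        map_smul' := fun c f => by
          rw [RingHom.id_apply, ← map_smul]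
          exact key _ _ (by rw [map_smul, hs, hs])
        cont := hR.isQuotientMap.continuous_iff.2
          (S.continuous.congr fun f => key _ _ (hs _).symm) }
    exact ⟨T, Subtype.ext (ContinuousLinearMap.ext fun f => key _ _ (hs _))⟩
  let e := LinearEquiv.ofBijective P.toLinearMap ⟨hinj, hsurj⟩
  refine ⟨⟨e, P.continuous, ?_⟩, hP⟩
  refine continuous_of_continuousAt_zero e.symm.toLinearMap.toAddMonoidHom ?_
  rw [ContinuousAt, map_zero]
  refine ContinuousLinearMap.hasBasis_nhds_zero.tendsto_right_iff.2 fun BV hBV => ?_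
  -- The seminorm bounds make s preserve bounded sets, so smallness of S on s(B) is smallness of the
  -- preimage functional on B.
  have hB : Bornology.IsVonNBounded ℂ (s '' BV.1) := by
    rw [(schwartz_withSeminorms ℂ (Euc d) ℂ).image_isVonNBounded_iff_seminorm_bounded]
    intro i
    obtain ⟨I, C, hC⟩ := hsb i
    obtain ⟨r, hr, hrB⟩ :=
      (withSeminorms d).isVonNBounded_iff_finset_seminorm_bounded.1 hBV.1 I
    refine ⟨C * r + 1, by positivity, fun f hf => (hC f).trans_lt ?_⟩
    have := mul_le_mul_of_nonneg_left (hrB f hf).le C.2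
    exact this.trans_lt (lt_add_one _)
  have hcoe : Filter.Tendsto (fun S : supportedDistributions d => (S : StrongDual ℂ 𝓢(Euc d, ℂ)))
      (𝓝 0) (𝓝 0) := continuous_subtype_val.tendsto _
  filter_upwards [hcoe.eventually (ContinuousLinearMap.hasBasis_nhds_zero.mem_of_mem
    (i := (s '' BV.1, BV.2)) ⟨hB, hBV.2⟩)] with S hS f hf
  have h := hS (s f) (Set.mem_image_of_mem s hf)
  have e1 : (S : StrongDual ℂ 𝓢(Euc d, ℂ)) (s f) = e.symm S f := by
    conv_lhs => rw [← e.apply_symm_apply S]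
    exact (hP (e.symm S) (s f)).trans (by rw [hs])
  rw [e1] at h
  exact h

end OrthantSchwartz

end

open OrthantSchwartz in
theorem mainTheorem1 (d : ℕ) :
    IsOpenQuotientMap (restrict d) ∧
    (∃ Φ : (𝓢(Euc d, ℂ) ⧸ nullSpace d) ≃L[ℂ] Space d,
      ∀ f : 𝓢(Euc d, ℂ), Φ (Submodule.Quotient.mk f) = restrict d f) ∧
    IsClosed (supportedDistributions d : Set (StrongDual ℂ 𝓢(Euc d, ℂ))) ∧
    ∃ Ψ : StrongDual ℂ (Space d) ≃L[ℂ] supportedDistributions d,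
      ∀ (T : StrongDual ℂ (Space d)) (f : 𝓢(Euc d, ℂ)),
        (Ψ T : StrongDual ℂ 𝓢(Euc d, ℂ)) f = T (restrict d f) :=
  ⟨isOpenQuotientMap_restrict d, exists_quotient_equiv d, isClosed_supportedDistributions d,
    exists_dual_equiv d⟩
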